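/- Notation. $H$ is the hyperbolic plane; $A_n(-1), D_n(-1), E_n(-1)$ are the negative-definite root lattices; $N$ is the Nikulin lattice, i.e. the lattice generated by pairwise orthogonal vectors $e_1,\dots,e_8$ with $e_i^2=-2$ together with $\tfrac12(e_1+\dots+e_8)$. For an even non-degenerate lattice $M$ let $D(M)=M^\vee/M$ be the discriminant group, with quadratic form $q_M\colon D(M)\to\mathbb{Q}/2\mathbb{Z}$, $q_M(x+M)=(x,x)$; $O(M)$ and $O(D(M))$ are the isometry groups of $M$ and of $(D(M),q_M)$. Let $X$ be a complex K3 surface or, more generally, any Hodge structure of K3 type on a lattice $H^2(X,\mathbb{Z})$ isometric to $H^{\oplus 3}\oplus E_8(-1)^{\oplus 2}$, i.e. one given by a period $\omega$ with $(\omega,\omega)=0$, $(\omega,\bar\omega)>0$, $H^{2,0}=\mathbb{C}\omega$, $H^{0,2}=\mathbb{C}\bar\omega$ and $H^{1,1}=\langle\omega,\bar\omega\rangle^\perp$. Put $NS(X)=H^2(X,\mathbb{Z})\cap H^{1,1}$ and $T_X=NS(X)^\perp$, and let $O_h(T_X)$ be the group of isometries of $T_X$ that preserve the Hodge decomposition.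 For a primitive lattice embedding $j\colon H\hookrightarrow NS(X)$ let $K=j(H)^\perp\subset NS(X)$, let $K^{\mathrm{root}}\subseteq K$ be the sublattice spanned by the vectors of self-intersection $-2$, and let $W=K/K^{\mathrm{root}}$; the pair $(K^{\mathrm{root}},W)$ is the frame of $j$. Since $NS(X)=j(H)\oplus K$ and $H^2(X,\mathbb{Z})$ is unimodular, there are canonical isomorphisms $D(T_X)\cong D(NS(X))\cong D(K)$. Let $\mathcal{B}\le O(D(K))$ be the image of $O(K)\to O(D(K))$ and let $\mathcal{C}\le O(D(K))$ be the image of $O_h(T_X)\to O(D(T_X))\cong O(D(K))$. The (Festi-Veniani) multiplicity associated with the frame is the number of elements of the double coset set $\mathcal{C}\backslash O(D(K))/\mathcal{B}$. Theorem. Let $(L,R)$ be one of the following pairs: $$\begin{array}{l|l} L & R\\ \hline H\oplus N & A_1(-1)^{\oplus 8}\\ H\oplus D_4(-1)\oplus A_1(-1)^{\oplus 5} & A_1(-1)^{\oplus 9}\\ H\oplus D_6(-1)\oplus A_1(-1)^{\oplus 4} & D_4(-1)\oplus A_1(-1)^{\oplus 6}\\ H\oplus E_7(-1)\oplus A_1(-1)^{\oplus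 4} & D_6(-1)\oplus A_1(-1)^{\oplus 5}\\ H\oplus D_8(-1)\oplus D_4(-1) & E_7(-1)\oplus A_1(-1)^{\oplus 5}\\ H\oplus E_8(-1)\oplus A_1(-1)^{\oplus 4} & D_8(-1)\oplus A_1(-1)^{\oplus 4}\\ H\oplus E_8(-1)\oplus D_4(-1)\oplus A_1(-1) & D_{10}(-1)\oplus A_1(-1)^{\oplus 3}\\ H\oplus E_8(-1)\oplus D_6(-1) & D_{12}(-1)\oplus A_1(-1)^{\oplus 2}\\ H\oplus E_8(-1)\oplus E_7(-1) & D_{14}(-1)\oplus A_1(-1)\\ H\oplus E_8(-1)\oplus E_8(-1) & D_{16}(-1)\\ H\oplus E_8(-1)\oplus E_8(-1)\oplus A_1(-1) & D_{16}(-1)\oplus A_1(-1)\\ H\oplus E_8(-1)\oplus E_8(-1)\oplus A_1(-1) & E_7(-1)\oplus D_{10}(-1) \end{array}$$ Then for every $X$ with $NS(X)\cong L$ and every primitive embedding $j\colon H\hookrightarrow NS(X)$ with frame $(K^{\mathrm{root}},W)\cong(R,\mathbb{Z}/2\mathbb{Z})$, the multiplicity associated with this frame equals one, i.e. $|\mathcal{C}\backslash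 O(D(K))/\mathcal{B}|=1$. -/

import Mathlib

open scoped TensorProduct

/-! ### Even lattices, discriminant forms, isometry groups -/

/-- An even integral symmetric bilinear form on an abelian group `M`. -/
structure EvenForm (M : Type*) [AddCommGroup M] where
  /-- the bilinear form -/
  form : LinearMap.BilinForm ℤ M
  symm : ∀ x y, form x y = form y x
  even : ∀ x, Even (form x x)

namespace EvenForm

variable {M : Type*} [AddCommGroup M] (E : EvenForm M)

/-- The form restricted to a sublattice. -/
def restrict (N : Submodule ℤ M) : EvenForm N where
  form := E.form.restrict N
  symm x y := E.symm x y
  even x := E.even x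

/-- The rational extension of the form to `ℚ ⊗ M`. -/
noncomputable def ratForm : LinearMap.BilinForm ℚ (ℚ ⊗[ℤ] M) := E.form.baseChange ℚ

/-- The image of `M` in `ℚ ⊗ M`. -/
def latticeIn (M : Type*) [AddCommGroup M] : Submodule ℤ (ℚ ⊗[ℤ] M) :=
  LinearMap.range (TensorProduct.mk ℤ ℚ M 1)

/-- The dual lattice `M^∨ = {x ∈ ℚ ⊗ M | (x, m) ∈ ℤ for all m ∈ M}`. -/
noncomputable def dual : Submodule ℤ (ℚ ⊗[ℤ] M) := E.ratForm.dualSubmodule (latticeIn M)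

/-- The discriminant group `D(M) = M^∨ / M`. -/
abbrev Disc : Type _ := E.dual ⧸ (latticeIn M).submoduleOf E.dual

lemma ratForm_symm (x y : ℚ ⊗[ℤ] M) : E.ratForm x y = E.ratForm y x := by
  have h : LinearMap.IsSymm E.form := ⟨fun x y => E.symm x y⟩
  exact (LinearMap.BilinForm.IsSymm.baseChange ℚ h).eq x y

/-- The discriminant quadratic form `q : D(M) → ℚ/2ℤ`, `q(x + M) = (x, x) mod 2ℤ`. -/
noncomputable def discForm : E.Disc → AddCircle (2 : ℚ) :=
  Quotient.lift (fun x : E.dual => ((E.ratForm x x : ℚ) : AddCircle (2 : ℚ))) (by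
    intro x y hxy
    have h : x - y ∈ (latticeIn M).submoduleOf E.dual :=
      (Submodule.quotientRel_def _).1 hxy
    obtain ⟨m, hm⟩ : ∃ m : M, (1 : ℚ) ⊗ₜ[ℤ] m = (x : ℚ ⊗[ℤ] M) - y := h
    obtain ⟨k, hk⟩ : ∃ k : ℤ, algebraMap ℤ ℚ k = E.ratForm y ((1 : ℚ) ⊗ₜ[ℤ] m) :=
      Submodule.mem_one.1 (y.2 _ ⟨m, rfl⟩)
    obtain ⟨c, hc⟩ := E.even m
    have hx : (x : ℚ ⊗[ℤ] M) = y + (1 : ℚ) ⊗ₜ[ℤ] m := by rw [hm]; abel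
    have hmm : E.ratForm ((1 : ℚ) ⊗ₜ[ℤ] m) ((1 : ℚ) ⊗ₜ[ℤ] m) = (E.form m m : ℚ) := by
      simp [ratForm]
    change ((E.ratForm x x : ℚ) : AddCircle (2 : ℚ)) = ((E.ratForm y y : ℚ) : AddCircle (2 : ℚ))
    refine (QuotientAddGroup.eq_iff_sub_mem).2 (AddSubgroup.mem_zmultiples_iff.2 ⟨k + c, ?_⟩)
    simp only [eq_intCast] at hk
    rw [hx]
    simp only [map_add, LinearMap.add_apply]
    rw [E.ratForm_symm (1 ⊗ₜ[ℤ] m) y, hmm, ← hk, hc]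
    push_cast
    simp
    ring)

/-- The isometry group `O(M)`. -/
def isometryGroup : Subgroup (M ≃ₗ[ℤ] M) where
  carrier := {g | ∀ x y, E.form (g x) (g y) = E.form x y}
  one_mem' _ _ := rfl
  mul_mem' {g h} hg hh x y := (hg (h x) (h y)).trans (hh x y)
  inv_mem' {g} hg x y := by
    have h := hg (g⁻¹ x) (g⁻¹ y)
    have e : ∀ z, g (g⁻¹ z) = z := fun z => g.apply_symm_apply z
    rw [e, e] at h
    exact h.symm

/-- The group `O(D(M))` of automorphisms of `D(M)` preserving the discriminant form. -/
def discIsometryGroup : Subgroup (E.Disc ≃ₗ[ℤ] E.Disc) where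
  carrier := {a | ∀ x, E.discForm (a x) = E.discForm x}
  one_mem' _ := rfl
  mul_mem' {a b} ha hb x := (ha (b x)).trans (hb x)
  inv_mem' {a} ha x := by
    have h := ha (a⁻¹ x)
    have e : a (a⁻¹ x) = x := a.apply_symm_apply x
    rw [e] at h
    exact h.symm

/-- The rational extension `ℚ ⊗ M ≃ ℚ ⊗ M` of an automorphism of `M`. -/
noncomputable def ratEquiv (g : M ≃ₗ[ℤ] M) : (ℚ ⊗[ℤ] M) ≃ₗ[ℤ] (ℚ ⊗[ℤ] M) :=
  LinearEquiv.lTensor ℚ g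

@[simp] lemma ratEquiv_tmul (g : M ≃ₗ[ℤ] M) (a : ℚ) (m : M) :
    ratEquiv g (a ⊗ₜ[ℤ] m) = a ⊗ₜ[ℤ] g m := rfl

lemma ratForm_ratEquiv {g : M ≃ₗ[ℤ] M} (hg : g ∈ E.isometryGroup) (x y : ℚ ⊗[ℤ] M) :
    E.ratForm (ratEquiv g x) (ratEquiv g y) = E.ratForm x y := by
  induction x with
  | zero => simp
  | add a b ha hb => simp [ha, hb]
  | tmul a m =>
    induction y with
    | zero => simp
    | add a b ha hb => simp only [map_add, ha, hb]
    | tmul b n =>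
      change (E.form (g m) (g n)) • (a * b) = (E.form m n) • (a * b)
      rw [hg m n]

lemma ratEquiv_latticeIn (g : M ≃ₗ[ℤ] M) (x : ℚ ⊗[ℤ] M) :
    ratEquiv g x ∈ latticeIn M ↔ x ∈ latticeIn M := by
  constructor
  · rintro ⟨m, hm⟩
    refine ⟨g.symm m, (ratEquiv g).injective ?_⟩
    rw [← hm]
    change (1 : ℚ) ⊗ₜ[ℤ] g (g.symm m) = (1 : ℚ) ⊗ₜ[ℤ] m
    rw [g.apply_symm_apply]
  · rintro ⟨m, rfl⟩
    exact ⟨g m, rfl⟩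

lemma ratEquiv_dual {g : M ≃ₗ[ℤ] M} (hg : g ∈ E.isometryGroup) (x : ℚ ⊗[ℤ] M) :
    ratEquiv g x ∈ E.dual ↔ x ∈ E.dual := by
  constructor
  · intro h y hy
    rw [← E.ratForm_ratEquiv hg]
    exact h _ ((ratEquiv_latticeIn g y).2 hy)
  · intro h y hy
    obtain ⟨z, rfl⟩ := (ratEquiv g).surjective y
    rw [E.ratForm_ratEquiv hg]
    exact h _ ((ratEquiv_latticeIn g z).1 hy)

/-- The action of an isometry on the dual lattice. -/
noncomputable def dualEquiv (g : E.isometryGroup) : E.dual ≃ₗ[ℤ] E.dual :=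
  (ratEquiv (g : M ≃ₗ[ℤ] M)).ofSubmodules E.dual E.dual (by
    ext y
    constructor
    · rintro ⟨x, hx, rfl⟩
      exact (E.ratEquiv_dual g.2 x).2 hx
    · intro hy
      obtain ⟨x, rfl⟩ := (ratEquiv (g : M ≃ₗ[ℤ] M)).surjective y
      exact ⟨x, (E.ratEquiv_dual g.2 x).1 hy, rfl⟩)

@[simp] lemma coe_dualEquiv (g : E.isometryGroup) (x : E.dual) :
    (E.dualEquiv g x : ℚ ⊗[ℤ] M) = ratEquiv (g : M ≃ₗ[ℤ] M) x := rfl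

/-- The automorphism of `D(M)` induced by an isometry of `M`. -/
noncomputable def discEquiv (g : E.isometryGroup) : E.Disc ≃ₗ[ℤ] E.Disc :=
  Submodule.Quotient.equiv _ _ (E.dualEquiv g) (by
    ext y
    constructor
    · rintro ⟨x, hx, rfl⟩
      exact (ratEquiv_latticeIn (g : M ≃ₗ[ℤ] M) (x : ℚ ⊗[ℤ] M)).2 hx
    · intro hy
      obtain ⟨x, rfl⟩ := (E.dualEquiv g).surjective y
      exact ⟨x, (ratEquiv_latticeIn (g : M ≃ₗ[ℤ] M) (x : ℚ ⊗[ℤ] M)).1 hy, rfl⟩)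

lemma discEquiv_mk (g : E.isometryGroup) (x : E.dual) :
    E.discEquiv g (Submodule.Quotient.mk x) = Submodule.Quotient.mk (E.dualEquiv g x) := rfl

/-- The natural homomorphism `O(M) → O(D(M))`. -/
noncomputable def discHom : E.isometryGroup →* E.discIsometryGroup where
  toFun g := ⟨E.discEquiv g, by
    intro x
    obtain ⟨x, rfl⟩ := Submodule.Quotient.mk_surjective _ x
    exact congrArg (fun t : ℚ => (t : AddCircle (2 : ℚ))) (E.ratForm_ratEquiv g.2 x x)⟩
  map_one' := by
    apply Subtype.ext
    ext x
    obtain ⟨x, rfl⟩ := Submodule.Quotient.mk_surjective _ x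
    refine congrArg Submodule.Quotient.mk (Subtype.ext ?_)
    exact LinearMap.congr_fun (LinearMap.lTensor_id ℚ M) (x : ℚ ⊗[ℤ] M)
  map_mul' g h := by
    apply Subtype.ext
    ext x
    obtain ⟨x, rfl⟩ := Submodule.Quotient.mk_surjective _ x
    refine congrArg Submodule.Quotient.mk (Subtype.ext ?_)
    exact LinearMap.lTensor_comp_apply ℚ (g : M ≃ₗ[ℤ] M).toLinearMap
      (h : M ≃ₗ[ℤ] M).toLinearMap (x : ℚ ⊗[ℤ] M)

/-- For a negative-definite lattice, the sublattice `M^root` spanned by the roots, that is, by the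
vectors of self-intersection `-2`. -/
def root : Submodule ℤ M := Submodule.span ℤ {x | E.form x x = -2}

end EvenForm

/-! ### Standard lattices -/

/-- Names of some standard indecomposable building blocks. -/
inductive LatticeBlock where
  /-- the hyperbolic plane `H` -/
  | H
  /-- the negative-definite Nikulin lattice `N` of rank eight -/
  | N
  /-- the negative-definite root lattice `A_n(-1)` -/
  | A (n : ℕ)
  /-- the negative-definite root lattice `D_n(-1)` -/
  | D (n : ℕ)
  /-- the negative-definite root lattice `E_7(-1)` -/
  | E7
  /-- the negative-definite root lattice `E_8(-1)` -/
  | E8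

namespace LatticeBlock

/-- The rank of a block. -/
def rank : LatticeBlock → ℕ
  | H => 2
  | N => 8
  | A n => n
  | D n => n
  | E7 => 7
  | E8 => 8

/-- The Gram matrix of `N` in the basis `e₁, …, e₇, (e₁ + ⋯ + e₈)/2`, where `e₁, …, e₈` are
pairwise orthogonal of self-intersection `-2`. -/
def nikulinGram : Matrix (Fin 8) (Fin 8) ℤ :=
  !![-2, 0, 0, 0, 0, 0, 0, -1;
     0, -2, 0, 0, 0, 0, 0, -1;
     0, 0, -2, 0, 0, 0, 0, -1;
     0, 0, 0, -2, 0, 0, 0, -1;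
     0, 0, 0, 0, -2, 0, 0, -1;
     0, 0, 0, 0, 0, -2, 0, -1;
     0, 0, 0, 0, 0, 0, -2, -1;
     -1, -1, -1, -1, -1, -1, -1, -4]

/-- The Gram matrix of a block. -/
def gram : (b : LatticeBlock) → Matrix (Fin b.rank) (Fin b.rank) ℤ
  | H => !![0, 1; 1, 0]
  | N => nikulinGram
  | A n => -CartanMatrix.A n
  | D n => -CartanMatrix.D n
  | E7 => -CartanMatrix.E₇
  | E8 => -CartanMatrix.E₈

/-- Coordinates on the orthogonal direct sum of a list of blocks. -/
abbrev Index (l : List LatticeBlock) : Type := Σ i : Fin l.length, Fin (l.get i).rank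

/-- The bilinear form of the orthogonal direct sum of a list of blocks. -/
def sumForm (l : List LatticeBlock) : LinearMap.BilinForm ℤ (Index l → ℤ) :=
  Matrix.toBilin' (Matrix.blockDiagonal' fun i : Fin l.length => (l.get i).gram)

/-- The K3 lattice `H^3 ⊕ E_8(-1)^2`. -/
def k3 : List LatticeBlock := [H, H, H, E8, E8]

/-- The pairs `(L, K^root)`: `L` runs through the eleven lattices of the classification, and
`(K^root, ℤ/2)` through the frames of `L` that have Mordell-Weil group `ℤ/2`. -/
def alternateFrames : List (List LatticeBlock × List LatticeBlock) :=
  [ ([H, N], List.replicate 8 (A 1)),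
    ([H, D 4] ++ List.replicate 5 (A 1), List.replicate 9 (A 1)),
    ([H, D 6] ++ List.replicate 4 (A 1), D 4 :: List.replicate 6 (A 1)),
    ([H, E7] ++ List.replicate 4 (A 1), D 6 :: List.replicate 5 (A 1)),
    ([H, D 8, D 4], E7 :: List.replicate 5 (A 1)),
    ([H, E8] ++ List.replicate 4 (A 1), D 8 :: List.replicate 4 (A 1)),
    ([H, E8, D 4, A 1], D 10 :: List.replicate 3 (A 1)),
    ([H, E8, D 6], D 12 :: List.replicate 2 (A 1)),
    ([H, E8, E7], [D 14, A 1]),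
    ([H, E8, E8], [D 16]),
    ([H, E8, E8, A 1], [D 16, A 1]),
    ([H, E8, E8, A 1], [E7, D 10]) ]

end LatticeBlock

/-! ### Hodge structures of K3 surfaces -/

/-- A Hodge structure of K3 type on `Λ`: the datum carried by `Λ = H²(X, ℤ)` of a complex K3
surface `X`, where `period` is the class of a nowhere vanishing holomorphic two-form. -/
structure K3HodgeStructure (Λ : Type*) [AddCommGroup Λ] extends EvenForm Λ where
  /-- the intersection form is isometric to the K3 lattice -/
  marking : form.Equivalent (LatticeBlock.sumForm LatticeBlock.k3)
  /-- a generator of `H^{2,0}` -/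
  period : ℂ ⊗[ℤ] Λ
  period_sq : form.baseChange ℂ period period = 0
  period_pos : 0 < (form.baseChange ℂ period
    (LinearMap.rTensor Λ (starRingEnd ℂ).toAddMonoidHom.toIntLinearMap period)).re

namespace K3HodgeStructure

variable {Λ : Type*} [AddCommGroup Λ] (X : K3HodgeStructure Λ)

/-- The complex conjugate of the period. -/
noncomputable def periodConj : ℂ ⊗[ℤ] Λ :=
  LinearMap.rTensor Λ (starRingEnd ℂ).toAddMonoidHom.toIntLinearMap X.period

/-- The Hodge decomposition: `X.hodge p` is `H^{p, 2-p}`. -/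
noncomputable def hodge (p : Fin 3) : Submodule ℂ (ℂ ⊗[ℤ] Λ) :=
  match p with
  | 0 => Submodule.span ℂ {X.periodConj}
  | 1 => (X.form.baseChange ℂ).orthogonal (Submodule.span ℂ {X.period, X.periodConj})
  | 2 => Submodule.span ℂ {X.period}

/-- The Néron-Severi lattice `NS(X) = H²(X, ℤ) ∩ H^{1,1}`. -/
noncomputable def NS : Submodule ℤ Λ :=
  ((X.hodge 1).restrictScalars ℤ).comap (TensorProduct.mk ℤ ℂ Λ 1)

/-- The transcendental lattice `T_X = NS(X)^⊥`. -/
noncomputable def T : Submodule ℤ Λ := X.form.orthogonal X.NS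

/-- The intersection form on the transcendental lattice. -/
noncomputable abbrev formT : EvenForm X.T := X.toEvenForm.restrict X.T

/-- The Hodge decomposition of `ℂ ⊗ T_X`. -/
noncomputable def hodgeT (p : Fin 3) : Submodule ℂ (ℂ ⊗[ℤ] X.T) :=
  (X.hodge p).comap (X.T.subtype.baseChange ℂ)

/-- The group `O_h(T_X)` of isometries of `T_X` that preserve the Hodge decomposition. -/
noncomputable def hodgeIsometryGroup : Subgroup X.formT.isometryGroup where
  carrier := {h | ∀ (p : Fin 3) (z : ℂ ⊗[ℤ] X.T),
    LinearMap.baseChange ℂ (h : X.T ≃ₗ[ℤ] X.T).toLinearMap z ∈ X.hodgeT p ↔ z ∈ X.hodgeT p}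
  one_mem' p z := by
    have e : LinearMap.baseChange ℂ
        (((1 : X.formT.isometryGroup) : X.T ≃ₗ[ℤ] X.T)).toLinearMap z = z :=
      LinearMap.congr_fun (LinearMap.lTensor_id ℂ X.T) z
    rw [e]
  mul_mem' {g h} hg hh p z := by
    have e : LinearMap.baseChange ℂ ((g * h : X.formT.isometryGroup) : X.T ≃ₗ[ℤ] X.T).toLinearMap z
        = LinearMap.baseChange ℂ (g : X.T ≃ₗ[ℤ] X.T).toLinearMap
          (LinearMap.baseChange ℂ (h : X.T ≃ₗ[ℤ] X.T).toLinearMap z) :=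
      LinearMap.lTensor_comp_apply ℂ (g : X.T ≃ₗ[ℤ] X.T).toLinearMap
        (h : X.T ≃ₗ[ℤ] X.T).toLinearMap z
    rw [e, hg, hh]
  inv_mem' {g} hg p z := by
    have e : LinearMap.baseChange ℂ (g : X.T ≃ₗ[ℤ] X.T).toLinearMap
        (LinearMap.baseChange ℂ ((g⁻¹ : X.formT.isometryGroup) : X.T ≃ₗ[ℤ] X.T).toLinearMap z)
        = z := by
      refine (LinearMap.lTensor_comp_apply ℂ (g : X.T ≃ₗ[ℤ] X.T).toLinearMap
        ((g⁻¹ : X.formT.isometryGroup) : X.T ≃ₗ[ℤ] X.T).toLinearMap z).symm.trans ?_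
      have e' : (g : X.T ≃ₗ[ℤ] X.T).toLinearMap ∘ₗ
          ((g⁻¹ : X.formT.isometryGroup) : X.T ≃ₗ[ℤ] X.T).toLinearMap = LinearMap.id :=
        LinearMap.ext fun t => (g : X.T ≃ₗ[ℤ] X.T).apply_symm_apply t
      rw [e', LinearMap.lTensor_id]
      rfl
    rw [← hg p, e]

/-- A primitive lattice embedding `j : H ↪ NS(X)` of the hyperbolic plane. -/
structure HypEmbedding where
  /-- the embedding -/
  j : (Fin 2 → ℤ) →ₗ[ℤ] Λ
  isometric : ∀ x y, X.form (j x) (j y) = x 0 * y 1 + x 1 * y 0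
  mem_NS : ∀ x, j x ∈ X.NS
  primitive : ∀ (n : ℤ) (x : Λ), n ≠ 0 → x ∈ X.NS → n • x ∈ LinearMap.range j →
    x ∈ LinearMap.range j

namespace HypEmbedding

variable {X} (f : X.HypEmbedding)

/-- The frame lattice `K = j(H)^⊥` in `NS(X)`. -/
noncomputable def K : Submodule ℤ Λ := X.NS ⊓ X.form.orthogonal (LinearMap.range f.j)

/-- The intersection form on `K`. -/
noncomputable abbrev formK : EvenForm f.K := X.toEvenForm.restrict f.K

/-- The canonical correspondence between `D(K)` and `D(T_X)`. Since `H²(X, ℤ)` is unimodular,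
it is the graph of the composite `D(K) ≅ D(j(H) ⊕ K) = D(NS(X)) ≅ D(T_X)`: the class of
`u ∈ K^∨` corresponds to the class of `v ∈ T_X^∨` if and only if `u + v ∈ H²(X, ℤ)`. -/
def Glue (x : f.formK.Disc) (y : X.formT.Disc) : Prop :=
  ∃ (u : f.formK.dual) (v : X.formT.dual),
    Submodule.Quotient.mk u = x ∧ Submodule.Quotient.mk v = y ∧
    LinearMap.lTensor ℚ f.K.subtype (u : ℚ ⊗[ℤ] f.K) +
      LinearMap.lTensor ℚ X.T.subtype (v : ℚ ⊗[ℤ] X.T) ∈ EvenForm.latticeIn Λ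

/-- The subgroup `B ≤ O(D(K))`, the image of `O(K) → O(D(K))`. -/
noncomputable def B : Subgroup f.formK.discIsometryGroup := f.formK.discHom.range

/-- The subgroup `C ≤ O(D(K))`, the image of `O_h(T_X) → O(D(T_X)) ≅ O(D(K))`. -/
def C : Subgroup f.formK.discIsometryGroup where
  carrier := {a | ∃ h ∈ X.hodgeIsometryGroup, ∀ x y,
    f.Glue ((a : f.formK.Disc ≃ₗ[ℤ] f.formK.Disc) x)
      ((X.formT.discHom h : X.formT.Disc ≃ₗ[ℤ] X.formT.Disc) y) ↔ f.Glue x y}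
  one_mem' := ⟨1, one_mem _, fun x y => by rw [map_one]; rfl⟩
  mul_mem' := by
    rintro a b ⟨g, hg, ha⟩ ⟨h, hh, hb⟩
    refine ⟨g * h, mul_mem hg hh, fun x y => ?_⟩
    rw [map_mul]
    exact (ha _ _).trans (hb x y)
  inv_mem' := by
    rintro a ⟨g, hg, ha⟩
    refine ⟨g⁻¹, inv_mem hg, fun x y => ?_⟩
    rw [map_inv, ← ha]
    have e1 : (a : f.formK.Disc ≃ₗ[ℤ] f.formK.Disc)
        (((a⁻¹ : f.formK.discIsometryGroup) : f.formK.Disc ≃ₗ[ℤ] f.formK.Disc) x) = x :=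
      LinearEquiv.apply_symm_apply _ x
    have e2 : (X.formT.discHom g : X.formT.Disc ≃ₗ[ℤ] X.formT.Disc)
        ((((X.formT.discHom g)⁻¹ : X.formT.discIsometryGroup) :
          X.formT.Disc ≃ₗ[ℤ] X.formT.Disc) y) = y :=
      LinearEquiv.apply_symm_apply _ y
    rw [e1, e2]

/-- The multiplicity of the frame: the number of elements of `C \ O(D(K)) / B`. -/
noncomputable def multiplicity : ℕ :=
  Nat.card (DoubleCoset.Quotient (f.C : Set f.formK.discIsometryGroup)
    (f.B : Set f.formK.discIsometryGroup))

/-- The embedding has frame `(R, ℤ/2)`: `K^root` is isometric to the lattice `R`, and the factor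
group `K / K^root` is cyclic of order two. -/
def HasFrame (R : List LatticeBlock) : Prop :=
  (f.formK.restrict f.formK.root).form.Equivalent (LatticeBlock.sumForm R) ∧
    Nonempty ((f.K ⧸ f.formK.root) ≃+ ZMod 2)

end HypEmbedding

end K3HodgeStructure

/-!
The multiplicity is one because `O(K) → O(D(K))` is surjective, whatever the group `C` may be.

Let `Q = K^root`, a sublattice of index two in `K`. The root lattices `A₁`, `D_n` (`n` even) and
`E₇` have discriminant groups of exponent two, so `D(Q)` is a vector space over `𝔽₂`. Its elements,
called classes, are numbered by bit patterns `v`; `N v` is twice the minimal norm of the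
class in absolute value (`DualModel`, `LatticeBlock.exists_dualModel`), and this function alone
determines the discriminant form. The vectors of `K` outside `Q` make up one class
`γ ≠ 0`. It is isotropic since `K` is even, and its minimal norm is not `-2` since all roots of `K`
lie in `Q` (`exists_glue`). Moreover `D(K) = γ^⊥ / γ` (`presents`).

If `x ∈ K^∨` has norm `-1` and `2 x ∈ K`, the reflection in `2 x` is an isometry of `K` that acts on
`D(K)` as the transvection `y ↦ y + 2 (y, x) x` (`exists_transvection`). So it suffices that the
transvections in the classes of minimal norm `-1` generate `O(D(K))`. This follows from a stabilizer
chain: given an isometry that fixes some classes, one looks at the possible images `u` of a further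
class `v` and takes `u` back to `v` by at most two transvections fixing the former classes.
Two classes `u`, `v` that agree in this respect are swapped by the transvection in `u + v` as soon
as this is a class of norm `-1`. Characteristic classes come first in the chain, and isometries
preserve them; without this condition the images `u` would include some that no isometry reaches.
The finite verification for all possible `γ` is `FrameCode.check`, which the kernel evaluates, and
`FrameCode.Presents.mem_of_checkGlue` derives the generation statement from it.
-/

open scoped TensorProduct

/-! ### Computing with classes of a discriminant group -/

namespace FrameCode

/-- The list of all `k < n` with `p k`. -/
def filterBelow (p : ℕ → Bool) : ℕ → List ℕ
  | 0 => []
  | k + 1 => bif p k then k :: filterBelow p k else filterBelow p k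

/-- Whether `p k` holds for all `k < n`. -/
def allBelow (p : ℕ → Bool) : ℕ → Bool
  | 0 => true
  | k + 1 => p k && allBelow p k

/-- Membership in a list of natural numbers. -/
def memb (x : ℕ) : List ℕ → Bool
  | [] => false
  | y :: l => Nat.beq x y || memb x l

/-- Orthogonality of two classes modulo `1`. The norm of the class `v` is `-N v / 2` modulo `2`,
hence the bilinear form vanishes on `u`, `v` if and only if `N (u + v) = N u + N v` modulo `4`. -/
def orth (N : ℕ → ℕ) (u v : ℕ) : Bool := Nat.beq ((N (u ^^^ v) + 3 * (N u + N v)) % 4) 0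

/-- Whether at most `n` transvections in elements of `T` take the class `u` to `v` or `w`. -/
def reach (N : ℕ → ℕ) (T : List ℕ) (v w : ℕ) : ℕ → ℕ → Bool
  | 0, u => Nat.beq u v || Nat.beq u w
  | n + 1, u => Nat.beq u v || Nat.beq u w ||
      T.any fun x => !orth N u x && reach N T v w n (u ^^^ x)

/-- Whether each `u ∈ S` that could be the image of `v` under an isometry fixing `gens`
is taken to `v` by transvections in elements of `T`. Here `ch` is the list of characteristic
classes, `sp` the span of `gens`, and `w = v + γ` represents the same class as `v`. -/
def level (N : ℕ → ℕ) (ch S T sp gens : List ℕ) (v w : ℕ) : Bool :=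
  S.all fun u => !(Nat.beq (N u % 4) (N v % 4) &&
    (gens.all fun s => Nat.beq (N (u ^^^ s) % 4) (N (v ^^^ s) % 4)) &&
    (memb u ch == memb v ch) && !memb u sp) || reach N T v w 2 u

/-- The check `level` along the chain of pointwise stabilizers of the classes in a list; classes
in the span `sp` of the classes `gens` treated before are skipped. -/
def chain (N : ℕ → ℕ) (ch S : List ℕ) (γ : ℕ) : List ℕ → List ℕ → List ℕ → List ℕ → Bool
  | _, _, _, [] => true
  | T, sp, gens, v :: cs => bif memb v sp then chain N ch S γ T sp gens cs else
      level N ch S T sp gens v (v ^^^ γ) &&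
        chain N ch S γ (T.filter fun x => orth N x v) (sp ++ sp.map (v ^^^ ·)) (v :: gens) cs

/-- Representatives of `γ^⊥ / γ`. -/
def reps (N : ℕ → ℕ) (d γ : ℕ) : List ℕ :=
  filterBelow (fun v => Nat.ble v (v ^^^ γ) && orth N v γ) (2 ^ d)

/-- The characteristic classes, those with `b(c, x) = q(x)` modulo `1` for all `x`. -/
def charClasses (N : ℕ → ℕ) (S : List ℕ) : List ℕ :=
  S.filter fun c => S.all fun x => orth N c x == Nat.beq (N x % 2) 0

/-- The check `chain` for the form on `γ^⊥ / γ` and all classes of minimal norm `-1`. -/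
def checkGlue (N : ℕ → ℕ) (d γ : ℕ) : Bool :=
  chain N (charClasses N (reps N d γ)) (reps N d γ) γ
    (filterBelow (fun v => Nat.beq (N v) 2 && orth N v γ) (2 ^ d)) [0, γ] []
    (charClasses N (reps N d γ) ++ reps N d γ)

/-- The check `checkGlue` for all nonzero isotropic classes `γ` of minimal norm other than `-2`. -/
def check (N : ℕ → ℕ) (d : ℕ) : Bool :=
  allBelow (fun γ => Nat.beq γ 0 || !Nat.beq (N γ % 4) 0 || Nat.beq (N γ) 4 || checkGlue N d γ)
    (2 ^ d)

lemma mem_filterBelow {p : ℕ → Bool} {n k : ℕ} :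
    k ∈ filterBelow p n ↔ k < n ∧ p k = true := by
  induction n with
  | zero => simp [filterBelow]
  | succ n ih =>
    rw [filterBelow]
    cases h : p n <;> simp only [cond_true, cond_false, List.mem_cons, ih] <;> grind

lemma allBelow_iff {p : ℕ → Bool} {n : ℕ} : allBelow p n = true ↔ ∀ k < n, p k = true := by
  induction n with
  | zero => simp [allBelow]
  | succ n ih => rw [allBelow, Bool.and_eq_true, ih]; grind

lemma memb_iff {x : ℕ} {l : List ℕ} : memb x l = true ↔ x ∈ l := by
  induction l with
  | nil => simp [memb]
  | cons y l ih => simp [memb, ih]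

lemma orth_iff {N : ℕ → ℕ} {u v : ℕ} :
    orth N u v = true ↔ N (u ^^^ v) % 4 = (N u + N v) % 4 := by
  simp only [orth, Nat.beq_eq]; omega

lemma orth_comm (N : ℕ → ℕ) (u v : ℕ) : orth N u v = orth N v u := by
  rw [orth, orth, Nat.xor_comm, Nat.add_comm (N u)]

lemma mem_charClasses {N : ℕ → ℕ} {S : List ℕ} {c : ℕ} :
    c ∈ charClasses N S ↔ c ∈ S ∧ ∀ x ∈ S, (orth N c x = true ↔ N x % 2 = 0) := by
  rw [charClasses, List.mem_filter, List.all_eq_true]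
  refine and_congr_right fun _ => forall₂_congr fun x _ => ?_
  rw [beq_iff_eq, Bool.eq_iff_iff, Nat.beq_eq]

/-- A group `D` with a quadratic form `q` is presented as a quotient of `γ^⊥` if `π` maps the
classes `v < 2 ^ d` orthogonal to `γ` onto `D`, and `γ` to `0`, taking bitwise sums to sums, such
that `N v` modulo `4` encodes the value of `q` on `π v`. -/
structure Presents {D : Type*} [AddCommGroup D] (q : D → AddCircle (2 : ℚ)) (N : ℕ → ℕ)
    (d γ : ℕ) (π : ℕ → D) : Prop where
  lt : γ < 2 ^ d
  orth_self : orth N γ γ = true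
  map_glue : π γ = 0
  orth_xor : ∀ u v, u < 2 ^ d → v < 2 ^ d → orth N u γ = true → orth N v γ = true →
    orth N (u ^^^ v) γ = true
  map_xor : ∀ u v, u < 2 ^ d → v < 2 ^ d → orth N u γ = true → orth N v γ = true →
    π (u ^^^ v) = π u + π v
  surj : ∀ x, ∃ v < 2 ^ d, orth N v γ = true ∧ π v = x
  norm : ∀ u v, u < 2 ^ d → v < 2 ^ d → orth N u γ = true → orth N v γ = true →
    (q (π u) = q (π v) ↔ N u % 4 = N v % 4)

namespace Presents

variable {D : Type*} [AddCommGroup D] {q : D → AddCircle (2 : ℚ)} {N : ℕ → ℕ} {d γ : ℕ}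
  {π : ℕ → D} (P : Presents q N d γ π)


lemma xor_mem (P : Presents q N d γ π) {u v : ℕ} (hu : u < 2 ^ d ∧ orth N u γ = true)
    (hv : v < 2 ^ d ∧ orth N v γ = true) : u ^^^ v < 2 ^ d ∧ orth N (u ^^^ v) γ = true :=
  ⟨Nat.xor_lt_two_pow hu.1 hv.1, P.orth_xor _ _ hu.1 hv.1 hu.2 hv.2⟩

lemma map_xor' (P : Presents q N d γ π) {u v : ℕ} (hu : u < 2 ^ d ∧ orth N u γ = true)
    (hv : v < 2 ^ d ∧ orth N v γ = true) : π (u ^^^ v) = π u + π v :=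
  P.map_xor _ _ hu.1 hv.1 hu.2 hv.2

lemma map_xor_glue (P : Presents q N d γ π) {u : ℕ} (hu : u < 2 ^ d ∧ orth N u γ = true) :
    π (u ^^^ γ) = π u := by
  rw [P.map_xor' hu ⟨P.lt, P.orth_self⟩, P.map_glue, add_zero]

lemma mem_reps {v : ℕ} : v ∈ reps N d γ ↔
    v ≤ v ^^^ γ ∧ v < 2 ^ d ∧ orth N v γ = true := by
  rw [reps, mem_filterBelow, Bool.and_eq_true, Nat.ble_eq]
  tauto

lemma exists_rep (P : Presents q N d γ π) (x : D) : ∃ v ∈ reps N d γ, π v = x := by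
  obtain ⟨v, hv, ho, rfl⟩ := P.surj x
  rcases le_total v (v ^^^ γ) with h | h
  · exact ⟨v, mem_reps.2 ⟨h, hv, ho⟩, rfl⟩
  · refine ⟨v ^^^ γ, mem_reps.2 ⟨?_, P.xor_mem ⟨hv, ho⟩ ⟨P.lt, P.orth_self⟩⟩,
      P.map_xor_glue ⟨hv, ho⟩⟩
    rwa [Nat.xor_assoc, Nat.xor_self, Nat.xor_zero]

lemma norm_xor_eq (P : Presents q N d γ π) {α : D ≃ₗ[ℤ] D} (hα : ∀ x, q (α x) = q x)
    {u v u' v' : ℕ} (hu : u < 2 ^ d ∧ orth N u γ = true) (hv : v < 2 ^ d ∧ orth N v γ = true)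
    (hu' : u' < 2 ^ d ∧ orth N u' γ = true) (hv' : v' < 2 ^ d ∧ orth N v' γ = true)
    (h : α (π u) = π u') (h' : α (π v) = π v') : N (u' ^^^ v') % 4 = N (u ^^^ v) % 4 := by
  have h1 := P.xor_mem hu hv
  have h2 := P.xor_mem hu' hv'
  rw [← P.norm _ _ h2.1 h1.1 h2.2 h1.2, P.map_xor' hu hv, P.map_xor' hu' hv', ← h, ← h',
    ← map_add, hα]

lemma norm_eq (P : Presents q N d γ π) {α : D ≃ₗ[ℤ] D} (hα : ∀ x, q (α x) = q x)
    {u u' : ℕ} (hu : u < 2 ^ d ∧ orth N u γ = true) (hu' : u' < 2 ^ d ∧ orth N u' γ = true)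
    (h : α (π u) = π u') : N u' % 4 = N u % 4 := by
  rw [← P.norm _ _ hu'.1 hu.1 hu'.2 hu.2, ← h, hα]

lemma map_charClasses (P : Presents q N d γ π) {α : D ≃ₗ[ℤ] D} (hα : ∀ x, q (α x) = q x)
    {u u' : ℕ} (hu' : u' ∈ reps N d γ) (h : α (π u) = π u')
    (hc : u ∈ charClasses N (reps N d γ)) : u' ∈ charClasses N (reps N d γ) := by
  obtain ⟨hu, hc⟩ := mem_charClasses.1 hc
  refine mem_charClasses.2 ⟨hu', fun x' hx' => ?_⟩
  obtain ⟨x, hx, hxx⟩ := P.exists_rep (α.symm (π x'))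
  have hxx : α (π x) = π x' := by rw [hxx, LinearEquiv.apply_symm_apply]
  have h0 := hc x hx
  have hu := (mem_reps.1 hu).2
  have hu' := (mem_reps.1 hu').2
  have hx := (mem_reps.1 hx).2
  have hx' := (mem_reps.1 hx').2
  have h1 := P.norm_xor_eq hα hu hx hu' hx' h hxx
  have h2 := P.norm_eq hα hu hu' h
  have h3 := P.norm_eq hα hx hx' hxx
  rw [orth_iff] at h0 ⊢
  omega

variable {H : Subgroup (D ≃ₗ[ℤ] D)}

/-- The elements of `T` represent classes whose transvections belong to the group `H`. -/
def TransvectionsIn (N : ℕ → ℕ) (d γ : ℕ) (π : ℕ → D) (H : Subgroup (D ≃ₗ[ℤ] D))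
    (T : List ℕ) : Prop :=
  ∀ x ∈ T, (x < 2 ^ d ∧ orth N x γ = true) ∧ ∃ h ∈ H, ∀ u, u < 2 ^ d → orth N u γ = true →
    h (π u) = if orth N u x = true then π u else π (u ^^^ x)

lemma exists_of_reach (P : Presents q N d γ π) {T gens : List ℕ} {v : ℕ}
    (hT : TransvectionsIn N d γ π H T)
    (hg : ∀ s ∈ gens, s < 2 ^ d ∧ orth N s γ = true)
    (hTg : ∀ x ∈ T, ∀ s ∈ gens, orth N x s = true)
    (hv : v < 2 ^ d ∧ orth N v γ = true) (n : ℕ) :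
    ∀ u, u < 2 ^ d ∧ orth N u γ = true → reach N T v (v ^^^ γ) n u = true →
      ∃ h ∈ H, (∀ s ∈ gens, h (π s) = π s) ∧ h (π u) = π v := by
  have base : ∀ u, (Nat.beq u v || Nat.beq u (v ^^^ γ)) = true →
      ∃ h ∈ H, (∀ s ∈ gens, h (π s) = π s) ∧ h (π u) = π v := by
    intro u h
    refine ⟨1, one_mem _, fun _ _ => rfl, ?_⟩
    rw [Bool.or_eq_true, Nat.beq_eq, Nat.beq_eq] at h
    rcases h with rfl | rfl
    · rfl
    · exact P.map_xor_glue hv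
  induction n with
  | zero => exact fun u _ h => base u h
  | succ n ih =>
    intro u hu h
    rw [reach, Bool.or_eq_true] at h
    rcases h with h | h
    · exact base u h
    obtain ⟨x, hx, hux⟩ := List.any_eq_true.1 h
    rw [Bool.and_eq_true, Bool.not_eq_true'] at hux
    obtain ⟨hx1, h1, h1H, ht⟩ := hT x hx
    obtain ⟨h2, h2H, h2g, h2u⟩ := ih _ (P.xor_mem hu hx1) hux.2
    refine ⟨h2 * h1, mul_mem h2H h1H, fun s hs => ?_, ?_⟩
    · rw [LinearEquiv.mul_apply, ht s (hg s hs).1 (hg s hs).2, orth_comm, if_pos (hTg x hx s hs),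
        h2g s hs]
    · rw [LinearEquiv.mul_apply, ht u hu.1 hu.2, hux.1, if_neg Bool.false_ne_true, h2u]

lemma exists_of_level (P : Presents q N d γ π) {T sp gens : List ℕ} {v : ℕ}
    (hT : TransvectionsIn N d γ π H T)
    (hg : ∀ s ∈ gens, s < 2 ^ d ∧ orth N s γ = true)
    (hTg : ∀ x ∈ T, ∀ s ∈ gens, orth N x s = true)
    (hsp : ∀ s ∈ sp, ∀ β : D ≃ₗ[ℤ] D, (∀ g ∈ gens, β (π g) = π g) → β (π s) = π s)
    (hv : v ∈ reps N d γ)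
    (hl : level N (charClasses N (reps N d γ)) (reps N d γ) T sp gens v (v ^^^ γ) = true)
    {α : D ≃ₗ[ℤ] D} (hα : ∀ x, q (α x) = q x) (hαg : ∀ s ∈ gens, α (π s) = π s) :
    ∃ h ∈ H, (∀ s ∈ gens, h (π s) = π s) ∧ h (α (π v)) = π v := by
  obtain ⟨u, hu, huv⟩ := P.exists_rep (α (π v))
  have hu' := (mem_reps.1 hu).2
  have hv' := (mem_reps.1 hv).2
  have h := List.all_eq_true.1 hl u hu
  rw [Bool.or_eq_true] at h
  rcases h with h | h
  · by_cases hus : u ∈ sp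
    · -- Here `α` fixes `π u = α (π v)`, so that `π u = π v`.
      refine ⟨1, one_mem _, fun _ _ => rfl, ?_⟩
      have := hsp u hus α hαg
      rw [huv] at this
      exact α.injective this
    exfalso
    rw [Bool.not_eq_true', ← Bool.not_eq_true] at h
    apply h
    simp only [Bool.and_eq_true, Nat.beq_eq, List.all_eq_true, beq_iff_eq, Bool.not_eq_true',
      ← Bool.not_eq_true, memb_iff]
    refine ⟨⟨⟨P.norm_eq hα hv' hu' huv.symm, fun s hs =>
      P.norm_xor_eq hα hv' (hg s hs) hu' (hg s hs) huv.symm (hαg s hs)⟩, ?_⟩, hus⟩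
    rw [Bool.eq_iff_iff, memb_iff, memb_iff]
    refine ⟨fun hc => P.map_charClasses (α := α.symm) (fun x => ?_) hv ?_ hc, fun hc =>
      P.map_charClasses hα hu huv.symm hc⟩
    · rw [← hα, LinearEquiv.apply_symm_apply]
    · rw [huv, LinearEquiv.symm_apply_apply]
  · rw [← huv]
    exact P.exists_of_reach hT hg hTg hv' 2 u hu' h

/-- The stabilizer chain argument: modulo `H`, an isometry fixing the classes `gens` can be
modified to fix the classes in `cs`, too. -/
lemma exists_of_chain (P : Presents q N d γ π) (hH : ∀ h ∈ H, ∀ x, q (h x) = q x)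
    (cs : List ℕ) : ∀ (T sp gens : List ℕ), TransvectionsIn N d γ π H T →
    (∀ s ∈ gens, s < 2 ^ d ∧ orth N s γ = true) →
    (∀ x ∈ T, ∀ s ∈ gens, orth N x s = true) →
    (∀ s ∈ sp, (s < 2 ^ d ∧ orth N s γ = true) ∧
      ∀ β : D ≃ₗ[ℤ] D, (∀ g ∈ gens, β (π g) = π g) → β (π s) = π s) →
    (∀ v ∈ cs, v ∈ reps N d γ) →
    chain N (charClasses N (reps N d γ)) (reps N d γ) γ T sp gens cs = true →
    ∀ α : D ≃ₗ[ℤ] D, (∀ x, q (α x) = q x) → (∀ s ∈ gens, α (π s) = π s) →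
    ∃ h ∈ H, (∀ s ∈ gens, h (α (π s)) = π s) ∧ ∀ v ∈ cs, h (α (π v)) = π v := by
  induction cs with
  | nil =>
    intro T sp gens _ _ _ _ _ _ α _ hαg
    exact ⟨1, one_mem _, hαg, by simp⟩
  | cons v cs ih =>
    intro T sp gens hT hg hTg hsp hcs hc α hα hαg
    rw [List.forall_mem_cons] at hcs
    rw [chain] at hc
    cases hm : memb v sp with
    | true =>
      rw [hm, cond_true] at hc
      obtain ⟨h, hh, hhg, hhc⟩ := ih T sp gens hT hg hTg hsp hcs.2 hc α hα hαg
      refine ⟨h, hh, hhg, List.forall_mem_cons.2 ⟨?_, hhc⟩⟩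
      exact (hsp v (memb_iff.1 hm)).2 (α.trans h) hhg
    | false =>
      rw [hm, cond_false, Bool.and_eq_true] at hc
      obtain ⟨h1, h1H, h1g, h1v⟩ := P.exists_of_level hT hg hTg (fun s hs => (hsp s hs).2)
        hcs.1 hc.1 hα hαg
      have hv' := (mem_reps.1 hcs.1).2
      obtain ⟨h2, h2H, h2g, h2c⟩ := ih (T.filter fun x => orth N x v)
        (sp ++ sp.map (v ^^^ ·)) (v :: gens)
        (fun x hx => hT x (List.mem_filter.1 hx).1)
        (List.forall_mem_cons.2 ⟨hv', hg⟩)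
        (fun x hx => List.forall_mem_cons.2
          ⟨(List.mem_filter.1 hx).2, hTg x (List.mem_filter.1 hx).1⟩)
        (by
          intro s hs
          rcases List.mem_append.1 hs with hs | hs
          · exact ⟨(hsp s hs).1, fun β hβ =>
              (hsp s hs).2 β fun g hg => hβ g (List.mem_cons_of_mem _ hg)⟩
          · obtain ⟨t, ht, rfl⟩ := List.mem_map.1 hs
            refine ⟨P.xor_mem hv' (hsp t ht).1, fun β hβ => ?_⟩
            rw [P.map_xor' hv' (hsp t ht).1, map_add, hβ v List.mem_cons_self,
              (hsp t ht).2 β fun g hg => hβ g (List.mem_cons_of_mem _ hg)])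
        hcs.2 hc.2 (α.trans h1) (fun x => by rw [LinearEquiv.trans_apply, hH _ h1H, hα])
        (List.forall_mem_cons.2 ⟨h1v, fun s hs => by
          rw [LinearEquiv.trans_apply, hαg s hs, h1g s hs]⟩)
      rw [List.forall_mem_cons] at h2g
      exact ⟨h2 * h1, mul_mem h2H h1H, h2g.2, List.forall_mem_cons.2 ⟨h2g.1, h2c⟩⟩

/-- If the check succeeds, then the transvections in the classes of minimal norm `-1` generate the
isometry group of `q`. -/
theorem mem_of_checkGlue (P : Presents q N d γ π) (hc : checkGlue N d γ = true)
    (hH : ∀ h ∈ H, ∀ x, q (h x) = q x)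
    (hT : ∀ x < 2 ^ d, orth N x γ = true → N x = 2 →
      ∃ h ∈ H, ∀ u, u < 2 ^ d → orth N u γ = true →
        h (π u) = if orth N u x = true then π u else π (u ^^^ x))
    {α : D ≃ₗ[ℤ] D} (hα : ∀ x, q (α x) = q x) : α ∈ H := by
  have h0 : (0 : ℕ) < 2 ^ d ∧ orth N 0 γ = true := by
    rw [← Nat.xor_self γ]
    exact P.xor_mem ⟨P.lt, P.orth_self⟩ ⟨P.lt, P.orth_self⟩
  obtain ⟨h, hh, -, hs⟩ := P.exists_of_chain hH _ _ _ _
    (by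
      intro x hx
      rw [mem_filterBelow, Bool.and_eq_true, Nat.beq_eq] at hx
      exact ⟨⟨hx.1, hx.2.2⟩, hT x hx.1 hx.2.2 hx.2.1⟩)
    (by simp) (by simp)
    (by
      have hz : π 0 = 0 := by
        rw [← Nat.xor_self γ, P.map_xor_glue ⟨P.lt, P.orth_self⟩, P.map_glue]
      intro s hs
      simp only [List.mem_cons, List.not_mem_nil, or_false] at hs
      rcases hs with rfl | rfl
      · exact ⟨h0, fun β _ => by rw [hz, map_zero]⟩
      · exact ⟨⟨P.lt, P.orth_self⟩, fun β _ => by rw [P.map_glue, map_zero]⟩)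
    (by
      intro v hv
      rcases List.mem_append.1 hv with hv | hv
      · exact (mem_charClasses.1 hv).1
      · exact hv)
    hc α hα (by simp)
  have h1 : h * α = 1 := by
    ext x
    obtain ⟨v, hv, rfl⟩ := P.exists_rep x
    exact hs v (List.mem_append_right _ hv)
  rw [eq_inv_of_mul_eq_one_right h1]
  exact inv_mem hh

end Presents
end FrameCode

/-! ### Discriminant groups of exponent two -/

/-- A presentation of `P^∨ / P` for a lattice `P` with form `B`, provided that `2 P^∨ ⊆ P`.
The classes are numbered by `v < 2 ^ d`, with bitwise addition, and `rep v / 2 ∈ P^∨` is a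
representative of the class `v`, of norm `-N v / 2`. -/
structure DualModel {P : Type*} [AddCommGroup P] (B : LinearMap.BilinForm ℤ P) (d : ℕ)
    (N : ℕ → ℕ) (rep : ℕ → P) : Prop where
  norm : ∀ v < 2 ^ d, B (rep v) (rep v) = -2 * N v
  two_dvd : ∀ v < 2 ^ d, ∀ x, 2 ∣ B (rep v) x
  zero : rep 0 = 0
  add : ∀ u < 2 ^ d, ∀ v < 2 ^ d, ∃ y, rep u + rep v = rep (u ^^^ v) + (2 : ℤ) • y
  surj : ∀ t : P →ₗ[ℤ] ℤ, ∃ v < 2 ^ d, ∃ y, ∀ x, B (rep v + (2 : ℤ) • y) x = 2 * t x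
  nondeg : ∀ y, (∀ x, B y x = 0) → y = 0

/-- The orthogonal direct sum of two bilinear forms. -/
def prodForm {P Q : Type*} [AddCommGroup P] [AddCommGroup Q] (B : LinearMap.BilinForm ℤ P)
    (C : LinearMap.BilinForm ℤ Q) : LinearMap.BilinForm ℤ (P × Q) :=
  B.compl₁₂ (LinearMap.fst ℤ P Q) (LinearMap.fst ℤ P Q) +
    C.compl₁₂ (LinearMap.snd ℤ P Q) (LinearMap.snd ℤ P Q)

@[simp] lemma prodForm_apply {P Q : Type*} [AddCommGroup P] [AddCommGroup Q]
    (B : LinearMap.BilinForm ℤ P) (C : LinearMap.BilinForm ℤ Q) (x y : P × Q) :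
    prodForm B C x y = B x.1 y.1 + C x.2 y.2 := rfl

namespace DualModel

variable {P Q : Type*} [AddCommGroup P] [AddCommGroup Q] {B : LinearMap.BilinForm ℤ P}
  {C : LinearMap.BilinForm ℤ Q} {d e : ℕ} {N N' : ℕ → ℕ} {rep : ℕ → P} {rep' : ℕ → Q}

theorem prod (h : DualModel B d N rep) (h' : DualModel C e N' rep') :
    DualModel (prodForm B C) (d + e) (fun v => N (v % 2 ^ d) + N' (v / 2 ^ d))
      (fun v => (rep (v % 2 ^ d), rep' (v / 2 ^ d))) := by
  have hm : ∀ v, v % 2 ^ d < 2 ^ d := fun v => Nat.mod_lt _ (by positivity)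
  have hd : ∀ v, v < 2 ^ (d + e) → v / 2 ^ d < 2 ^ e := fun v hv => by
    rw [Nat.div_lt_iff_lt_mul (by positivity), ← pow_add, add_comm e]
    exact hv
  refine ⟨fun v hv => ?_, fun v hv x => ?_, ?_, fun u hu v hv => ?_, fun t => ?_, ?_⟩
  · rw [prodForm_apply, h.norm _ (hm v), h'.norm _ (hd v hv)]
    push_cast
    ring
  · exact dvd_add (h.two_dvd _ (hm v) _) (h'.two_dvd _ (hd v hv) _)
  · simp [h.zero, h'.zero]
  · obtain ⟨y, hy⟩ := h.add _ (hm u) _ (hm v)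
    obtain ⟨z, hz⟩ := h'.add _ (hd u hu) _ (hd v hv)
    refine ⟨(y, z), Prod.ext ?_ ?_⟩
    · simp only [Prod.fst_add, Prod.smul_fst, hy, Nat.xor_mod_two_pow]
    · simp only [Prod.snd_add, Prod.smul_snd, hz, Nat.xor_div_two_pow]
  · obtain ⟨v, hv, y, hy⟩ := h.surj (t ∘ₗ LinearMap.inl ℤ P Q)
    obtain ⟨w, hw, z, hz⟩ := h'.surj (t ∘ₗ LinearMap.inr ℤ P Q)
    have h1 : (v + 2 ^ d * w) % 2 ^ d = v := by
      rw [Nat.add_mul_mod_self_left, Nat.mod_eq_of_lt hv]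
    have h2 : (v + 2 ^ d * w) / 2 ^ d = w := by
      rw [Nat.add_mul_div_left _ _ (by positivity), Nat.div_eq_of_lt hv, zero_add]
    refine ⟨v + 2 ^ d * w, ?_, (y, z), fun x => ?_⟩
    · calc v + 2 ^ d * w < 2 ^ d * 1 + 2 ^ d * w := by omega
        _ = 2 ^ d * (1 + w) := by ring
        _ ≤ 2 ^ d * 2 ^ e := Nat.mul_le_mul_left _ (by omega)
        _ = 2 ^ (d + e) := (pow_add _ _ _).symm
    · rw [prodForm_apply]
      simp only [h1, h2, Prod.fst_add, Prod.snd_add, Prod.smul_fst, Prod.smul_snd, hy, hz]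
      rw [← mul_add, LinearMap.comp_apply, LinearMap.comp_apply, ← map_add]
      simp
  · intro y hy
    refine Prod.ext (h.nondeg _ fun x => ?_) (h'.nondeg _ fun x => ?_)
    · simpa using hy (x, 0)
    · simpa using hy (0, x)

theorem congr (h : DualModel B d N rep) (f : P ≃ₗ[ℤ] Q) (hf : ∀ x y, C (f x) (f y) = B x y) :
    DualModel C d N (fun v => f (rep v)) := by
  have hf' : ∀ x y, C (f x) y = B x (f.symm y) := fun x y => by
    rw [← hf, LinearEquiv.apply_symm_apply]
  refine ⟨fun v hv => ?_, fun v hv x => ?_, ?_, fun u hu v hv => ?_, fun t => ?_, ?_⟩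
  · rw [hf, h.norm v hv]
  · rw [hf']
    exact h.two_dvd v hv _
  · rw [h.zero, map_zero]
  · obtain ⟨y, hy⟩ := h.add u hu v hv
    exact ⟨f y, by rw [← map_add, hy, map_add, map_smul]⟩
  · obtain ⟨v, hv, y, hy⟩ := h.surj (t ∘ₗ f.toLinearMap)
    refine ⟨v, hv, f y, fun x => ?_⟩
    rw [← map_smul, ← map_add, hf', hy]
    simp
  · intro y hy
    rw [← f.apply_symm_apply y, h.nondeg (f.symm y), map_zero]
    intro x
    rw [← hf, LinearEquiv.apply_symm_apply, hy]

open Matrix in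
/-- A numerical criterion for the lattice with Gram matrix `-S`: the matrix `A` is twice the
inverse of `S`, and its rows represent classes. -/
theorem ofMatrix {n : ℕ} (S A : Matrix (Fin n) (Fin n) ℤ) (d : ℕ) (N : ℕ → ℕ)
    (rep : ℕ → Fin n → ℤ) (hAS : A * S = 2 • (1 : Matrix (Fin n) (Fin n) ℤ))
    (hSA : S * A = 2 • (1 : Matrix (Fin n) (Fin n) ℤ))
    (norm : ∀ v < 2 ^ d, (rep v ᵥ* S) ⬝ᵥ rep v = 2 * N v)
    (two_dvd : ∀ v < 2 ^ d, ∀ i, 2 ∣ (rep v ᵥ* S) i) (zero : ∀ i, rep 0 i = 0)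
    (add : ∀ u < 2 ^ d, ∀ v < 2 ^ d, ∀ i, 2 ∣ rep u i + rep v i - rep (u ^^^ v) i)
    (rows : ∀ j, ∃ v < 2 ^ d, ∀ i, 2 ∣ A j i - rep v i) :
    DualModel (Matrix.toBilin' (-S)) d N rep := by
  have hB : ∀ x y, Matrix.toBilin' (-S) x y = -((x ᵥ* S) ⬝ᵥ y) := fun x y => by
    rw [Matrix.toBilin'_apply', neg_mulVec, dotProduct_neg, dotProduct_mulVec]
  have two : ∀ x : Fin n → ℤ, (∀ i, 2 ∣ x i) → ∃ y, x = (2 : ℤ) • y := fun x hx => by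
    choose y hy using hx
    exact ⟨y, funext hy⟩
  refine ⟨fun v hv => ?_, fun v hv x => ?_, funext zero, fun u hu v hv => ?_, fun t => ?_, ?_⟩
  · rw [hB, norm v hv]
    ring
  · rw [hB, dvd_neg]
    exact Finset.dvd_sum fun i _ => (two_dvd v hv i).mul_right _
  · obtain ⟨y, hy⟩ := two _ (add u hu v hv)
    exact ⟨y, by rw [← hy]; funext i; simp⟩
  · -- The functional `t` is the product with half of `-τ A`, where `τ` lists its values on the
    -- basis; as the rows of `A` represent classes, so does each integral combination of them.
    let U : AddSubgroup (Fin n → ℤ) :=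
      { carrier := {x | ∃ v < 2 ^ d, ∃ y, x = rep v + (2 : ℤ) • y}
        zero_mem' := ⟨0, by positivity, 0, by rw [smul_zero, add_zero]; exact (funext zero).symm⟩
        add_mem' := by
          rintro _ _ ⟨u, hu, y, rfl⟩ ⟨v, hv, z, rfl⟩
          obtain ⟨w, hw⟩ := two _ (add u hu v hv)
          refine ⟨u ^^^ v, Nat.xor_lt_two_pow hu hv, y + z + w, ?_⟩
          rw [smul_add, smul_add, ← hw]
          funext i
          simp only [Pi.add_apply, Pi.smul_apply]
          ring
        neg_mem' := by
          rintro _ ⟨u, hu, y, rfl⟩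
          refine ⟨u, hu, -rep u - y, ?_⟩
          funext i
          simp only [Pi.neg_apply, Pi.add_apply, Pi.sub_apply, Pi.smul_apply, smul_eq_mul]
          ring }
    have hrow : ∀ j, A j ∈ U := fun j => by
      obtain ⟨v, hv, h⟩ := rows j
      obtain ⟨y, hy⟩ := two _ h
      exact ⟨v, hv, y, by rw [← hy]; funext i; simp⟩
    set τ : Fin n → ℤ := fun j => t fun i => if j = i then 1 else 0 with hτ
    have hU : -(τ ᵥ* A) ∈ U := by
      refine neg_mem ?_
      rw [vecMul_eq_sum]
      exact sum_mem fun j _ => U.zsmul_mem (hrow j) (τ j)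
    obtain ⟨v, hv, y, hy⟩ := hU
    refine ⟨v, hv, y, fun x => ?_⟩
    rw [← hy, hB, neg_vecMul, vecMul_vecMul, hAS, neg_dotProduct, neg_neg, vecMul_smul,
      vecMul_one, smul_dotProduct, LinearMap.pi_apply_eq_sum_univ t x, dotProduct]
    simp [hτ, mul_comm]
  · intro y hy
    have h0 : y ᵥ* S = 0 := by
      refine dotProduct_eq_zero _ fun x => ?_
      rw [← neg_eq_zero, ← hB, hy]
    have h1 : y ᵥ* (S * A) = 0 := by rw [← vecMul_vecMul, h0, zero_vecMul]
    rw [hSA, vecMul_smul, vecMul_one] at h1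
    exact (smul_eq_zero.1 h1).resolve_left two_ne_zero

end DualModel

/-! ### The discriminant groups of the root lattices -/

namespace LatticeBlock

/-- The exponent `d` for which the discriminant group of `A₁`, `D_n` with even `n`, `E₇` has
order `2 ^ d`. The value for other blocks has no meaning. -/
def bits : LatticeBlock → ℕ
  | A _ => 1
  | E7 => 1
  | _ => 2

/-- Twice the minimal norms of the classes in the discriminant group of `A₁`, `D_n` with even
`n`, `E₇`, up to sign. In the case of `D_n`, the classes `1` and `2` are the spinor classes
and `3` is the vector class. The values for other blocks have no meaning. -/
def classNorm : LatticeBlock → ℕ → ℕ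
  | A _, v => v
  | E7, v => 3 * v
  | D n, v => match v with
    | 0 => 0
    | 1 => n / 2
    | 2 => n / 2
    | _ => 2
  | _, _ => 0

/-- The number of bits for the discriminant group of an orthogonal direct sum. -/
def sumBits : List LatticeBlock → ℕ
  | [] => 0
  | b :: l => b.bits + sumBits l

/-- Twice the minimal norms of the classes in the discriminant group of an orthogonal direct sum,
up to sign. The lowest bits belong to the first summand. -/
def sumNorm : List LatticeBlock → ℕ → ℕ
  | [], _ => 0
  | b :: l, v => b.classNorm (v % 2 ^ b.bits) + sumNorm l (v / 2 ^ b.bits)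

/-- Twice the inverse of the Cartan matrix of `D_n`. -/
def twiceInvD (n : ℕ) : Matrix (Fin n) (Fin n) ℤ :=
  Matrix.of fun i j =>
    if i.val + 2 < n then
      if j.val + 2 < n then 2 * (min i.val j.val + 1 : ℕ) else (i.val + 1 : ℕ)
    else if j.val + 2 < n then (j.val + 1 : ℕ)
    else if i.val = j.val then (n / 2 : ℕ) else (n / 2 - 1 : ℕ)

/-- Twice the minimal representatives of the classes in the discriminant group of `D_n`. -/
def repD (n : ℕ) : ℕ → Fin n → ℤ
  | 0, _ => 0
  | 1, i => if i.val + 2 < n then (i.val + 1 : ℕ) else if i.val + 2 = n then (n / 2 - 1 : ℕ)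
      else (n / 2 : ℕ)
  | 2, i => if i.val + 2 < n then (i.val + 1 : ℕ) else if i.val + 2 = n then (n / 2 : ℕ)
      else (n / 2 - 1 : ℕ)
  | _, i => if i.val + 2 < n then 2 else 1

/-- Twice the inverse of the Cartan matrix of `E₇`. -/
def twiceInvE7 : Matrix (Fin 7) (Fin 7) ℤ :=
  !![4, 4, 6, 8, 6, 4, 2;
     4, 7, 8, 12, 9, 6, 3;
     6, 8, 12, 16, 12, 8, 4;
     8, 12, 16, 24, 18, 12, 6;
     6, 9, 12, 18, 15, 10, 5;
     4, 6, 8, 12, 10, 8, 4;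
     2, 3, 4, 6, 5, 4, 3]

/-- The block has a discriminant group as described by `bits` and `classNorm`. -/
def IsModeled (b : LatticeBlock) : Prop :=
  ∃ rep, DualModel (Matrix.toBilin' b.gram) b.bits b.classNorm rep

lemma isModeled_A_one : (A 1).IsModeled :=
  ⟨_, DualModel.ofMatrix (CartanMatrix.A 1) 1 1 (A 1).classNorm (fun v _ => v)
    (by decide) (by decide) (by decide) (by decide) (by decide) (by decide) (by decide)⟩

lemma isModeled_E7 : E7.IsModeled :=
  ⟨_, DualModel.ofMatrix CartanMatrix.E₇ twiceInvE7 1 E7.classNorm (fun v i => v * twiceInvE7 6 i)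
    (by decide +kernel) (by decide +kernel) (by decide +kernel) (by decide +kernel)
    (by decide +kernel) (by decide +kernel) (by decide +kernel)⟩

lemma isModeled_D {n : ℕ} (hn : n ∈ [4, 6, 8, 10, 12, 14, 16]) : (D n).IsModeled := by
  simp only [List.mem_cons, List.not_mem_nil, or_false] at hn
  refine ⟨_, DualModel.ofMatrix (CartanMatrix.D n) (twiceInvD n) 2 (D n).classNorm (repD n)
    ?_ ?_ ?_ ?_ ?_ ?_ ?_⟩ <;>
    rcases hn with rfl | rfl | rfl | rfl | rfl | rfl | rfl <;> decide +kernel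

lemma sumForm_apply (l : List LatticeBlock) (x y : Index l → ℤ) :
    sumForm l x y = ∑ i, ∑ j, ∑ k, x ⟨i, j⟩ * (l.get i).gram j k * y ⟨i, k⟩ := by
  rw [sumForm, Matrix.toBilin'_apply, Fintype.sum_sigma]
  refine Finset.sum_congr rfl fun i _ => Finset.sum_congr rfl fun j _ => ?_
  rw [Fintype.sum_sigma, Finset.sum_eq_single i]
  · simp [Matrix.blockDiagonal'_apply_eq]
  · intro i' _ hi
    refine Finset.sum_eq_zero fun k _ => ?_
    rw [Matrix.blockDiagonal'_apply_ne _ _ _ hi.symm, mul_zero, zero_mul]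
  · simp

/-- Splitting off the coordinates of the first summand. -/
def consEquiv (b : LatticeBlock) (l : List LatticeBlock) :
    ((Fin b.rank → ℤ) × (Index l → ℤ)) ≃ₗ[ℤ] (Index (b :: l) → ℤ) where
  toFun x p := match p with
    | ⟨⟨0, _⟩, k⟩ => x.1 k
    | ⟨⟨i + 1, h⟩, k⟩ => x.2 ⟨⟨i, Nat.lt_of_succ_lt_succ h⟩, k⟩
  invFun x := (fun k => x ⟨0, k⟩, fun p => x ⟨p.1.succ, p.2⟩)
  map_add' x y := by
    funext ⟨⟨i, _⟩, k⟩
    cases i <;> rfl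
  map_smul' c x := by
    funext ⟨⟨i, _⟩, k⟩
    cases i <;> rfl
  left_inv x := rfl
  right_inv x := by
    funext ⟨⟨i, _⟩, k⟩
    cases i <;> rfl

lemma sumForm_consEquiv (b : LatticeBlock) (l : List LatticeBlock)
    (x y : (Fin b.rank → ℤ) × (Index l → ℤ)) :
    sumForm (b :: l) (consEquiv b l x) (consEquiv b l y) =
      prodForm (Matrix.toBilin' b.gram) (sumForm l) x y := by
  rw [prodForm_apply, sumForm_apply, sumForm_apply, Matrix.toBilin'_apply]
  exact Fin.sum_univ_succ (n := l.length) _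

lemma exists_dualModel (l : List LatticeBlock) (hl : ∀ b ∈ l, b.IsModeled) :
    ∃ rep, DualModel (sumForm l) (sumBits l) (sumNorm l) rep := by
  induction l with
  | nil =>
    have h : ∀ x y : Index [] → ℤ, x = y := fun x y => funext fun p => p.1.elim0
    refine ⟨0, fun v _ => ?_, fun v _ x => ?_, rfl, fun u _ v _ => ⟨0, h _ _⟩,
      fun t => ⟨0, by positivity, 0, fun x => ?_⟩, fun y _ => h _ _⟩
    · simp [sumNorm]
    · simp
    · simp [h x 0]
  | cons b l ih =>
    rw [List.forall_mem_cons] at hl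
    obtain ⟨rep, hr⟩ := hl.1
    obtain ⟨rep', hr'⟩ := ih hl.2
    exact ⟨_, (hr.prod hr').congr (consEquiv b l) (sumForm_consEquiv b l)⟩

lemma isModeled_of_mem_alternateFrames {L R : List LatticeBlock}
    (h : (L, R) ∈ alternateFrames) : ∀ b ∈ R, b.IsModeled := by
  simp only [alternateFrames, List.mem_cons, Prod.mk.injEq, List.not_mem_nil, or_false] at h
  rcases h with ⟨-, rfl⟩ | ⟨-, rfl⟩ | ⟨-, rfl⟩ | ⟨-, rfl⟩ | ⟨-, rfl⟩ | ⟨-, rfl⟩ | ⟨-, rfl⟩ |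
    ⟨-, rfl⟩ | ⟨-, rfl⟩ | ⟨-, rfl⟩ | ⟨-, rfl⟩ | ⟨-, rfl⟩ <;>
  · simp only [List.forall_mem_cons, List.mem_replicate, and_imp, forall_eq,
      List.not_mem_nil, false_imp_iff, implies_true, and_true, ne_eq, OfNat.ofNat_ne_zero,
      not_false_eq_true, forall_const]
    simp [isModeled_A_one, isModeled_E7, isModeled_D]

lemma check_of_mem_alternateFrames {L R : List LatticeBlock} (h : (L, R) ∈ alternateFrames) :
    FrameCode.check (sumNorm R) (sumBits R) = true := by
  have h' : ∀ p ∈ alternateFrames, FrameCode.check (sumNorm p.2) (sumBits p.2) = true := by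
    decide +kernel
  exact h' _ h

end LatticeBlock

/-! ### Lattices with a root sublattice of index two -/

namespace EvenForm

variable {M : Type*} [AddCommGroup M] (E : EvenForm M)

lemma ratForm_tmul (a b : ℚ) (m n : M) :
    E.ratForm (a ⊗ₜ[ℤ] m) (b ⊗ₜ[ℤ] n) = E.form m n * (a * b) := by
  rw [ratForm, LinearMap.BilinForm.baseChange_tmul, zsmul_eq_mul]

lemma mem_dual_iff {x : ℚ ⊗[ℤ] M} :
    x ∈ E.dual ↔ ∀ m : M, ∃ k : ℤ, E.ratForm x (1 ⊗ₜ[ℤ] m) = k := by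
  constructor
  · intro h m
    obtain ⟨k, hk⟩ := Submodule.mem_one.1 (h _ ⟨m, rfl⟩)
    exact ⟨k, hk.symm⟩
  · rintro h _ ⟨m, rfl⟩
    obtain ⟨k, hk⟩ := h m
    exact Submodule.mem_one.2 ⟨k, hk.symm⟩

lemma latticeIn_le_dual : latticeIn M ≤ E.dual := by
  rintro _ ⟨m, rfl⟩
  refine E.mem_dual_iff.2 fun n => ⟨E.form m n, ?_⟩
  change E.ratForm (1 ⊗ₜ[ℤ] m) (1 ⊗ₜ[ℤ] n) = _
  rw [ratForm_tmul, one_mul, mul_one]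

/-- The reflection `y ↦ y - 2 (y, r) / (r, r) r` in a vector `r` with `(r, r) = -4`, for which the
products `(r, y) = 2 f y` are even. -/
def reflection (r : M) (f : M →ₗ[ℤ] ℤ) (hr : E.form r r = -4)
    (hf : ∀ y, E.form r y = 2 * f y) : E.isometryGroup :=
  have hfr : f r = -2 := by have := hf r; omega
  ⟨LinearEquiv.ofInvolutive (LinearMap.id + f.smulRight r) (fun y => by
      change (y + f y • r) + f (y + f y • r) • r = y
      rw [map_add, map_smul, hfr, smul_eq_mul, add_assoc, ← add_smul,
        show f y + (f y + f y * -2) = 0 by ring, zero_smul, add_zero]), fun x y => by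
    have hxr : E.form x r = 2 * f x := by rw [E.symm, hf]
    change E.form (x + f x • r) (y + f y • r) = E.form x y
    simp only [map_add, map_smul, LinearMap.add_apply, LinearMap.smul_apply, smul_eq_mul, hr, hf,
      hxr]
    ring⟩

lemma reflection_apply (r : M) (f : M →ₗ[ℤ] ℤ) (hr : E.form r r = -4)
    (hf : ∀ y, E.form r y = 2 * f y) (y : M) :
    (E.reflection r f hr hf : M ≃ₗ[ℤ] M) y = y + f y • r := rfl

lemma exists_half {r : M} (h : ∀ y, 2 ∣ E.form r y) :
    ∃ f : M →ₗ[ℤ] ℤ, ∀ y, E.form r y = 2 * f y := by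
  choose f hf using h
  refine ⟨{ toFun := f, map_add' := fun x y => ?_, map_smul' := fun c x => ?_ }, hf⟩
  · have := hf (x + y)
    rw [map_add, hf, hf] at this
    omega
  · have := hf (c • x)
    rw [map_smul, hf, smul_eq_mul] at this
    rw [RingHom.id_apply, smul_eq_mul]
    linarith

/-- A lattice without torsion whose root sublattice has index two and a discriminant group
described by `N`. -/
structure HasIndexTwoRoot (d : ℕ) (N : ℕ → ℕ) (rep : ℕ → E.root) : Prop where
  torsion : ∀ m : M, (2 : ℤ) • m = 0 → m = 0
  index : Nonempty ((M ⧸ E.root) ≃+ ZMod 2)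
  model : DualModel (E.restrict E.root).form d N rep

namespace HasIndexTwoRoot

variable {E} {d : ℕ} {N : ℕ → ℕ} {rep : ℕ → E.root}

lemma sub_mem_root (h : E.HasIndexTwoRoot d N rep) {m n : M} (hm : m ∉ E.root) (hn : n ∉ E.root) :
    m - n ∈ E.root := by
  obtain ⟨e⟩ := h.index
  have key : ∀ x : M, x ∉ E.root → e (E.root.mkQ x) = 1 := by
    intro x hx
    have h0 : e (E.root.mkQ x) ≠ 0 := by
      rw [Ne, map_eq_zero_iff e e.injective, Submodule.mkQ_apply, Submodule.Quotient.mk_eq_zero]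
      exact hx
    have : ∀ z : ZMod 2, z ≠ 0 → z = 1 := by decide
    exact this _ h0
  rw [← Submodule.Quotient.mk_eq_zero, ← Submodule.mkQ_apply, ← map_eq_zero_iff e e.injective,
    map_sub, map_sub, key m hm, key n hn, sub_self]

lemma exists_notMem (h : E.HasIndexTwoRoot d N rep) : ∃ m : M, m ∉ E.root := by
  obtain ⟨e⟩ := h.index
  obtain ⟨m, hm⟩ := Submodule.mkQ_surjective E.root (e.symm 1)
  refine ⟨m, fun hr => ?_⟩
  rw [Submodule.mkQ_apply, (Submodule.Quotient.mk_eq_zero _).2 hr, eq_comm,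
    map_eq_zero_iff _ e.symm.injective] at hm
  exact one_ne_zero hm

lemma two_smul_mem (h : E.HasIndexTwoRoot d N rep) (m : M) : (2 : ℤ) • m ∈ E.root := by
  by_cases hm : m ∈ E.root
  · exact E.root.smul_mem _ hm
  · have := h.sub_mem_root hm (fun hn => hm (neg_mem_iff.1 hn) : -m ∉ E.root)
    rwa [sub_neg_eq_add, ← two_smul ℤ m] at this

/-- The root sublattice spans `ℚ ⊗ M`. -/
lemma exists_smul_eq (h : E.HasIndexTwoRoot d N rep) (z : ℚ ⊗[ℤ] M) :
    ∃ n : ℤ, n ≠ 0 ∧ ∃ r ∈ E.root, (n : ℚ) • z = (1 : ℚ) ⊗ₜ[ℤ] r := by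
  induction z with
  | zero => exact ⟨1, one_ne_zero, 0, zero_mem _, by simp⟩
  | tmul a m =>
    refine ⟨2 * a.den, by simp, a.num • (2 : ℤ) • m, E.root.smul_mem _ (h.two_smul_mem m), ?_⟩
    have : ((2 * a.den : ℤ) : ℚ) * a = (a.num * 2 : ℤ) • (1 : ℚ) := by
      rw [zsmul_eq_mul, mul_one]
      push_cast
      rw [mul_assoc, mul_comm (a.den : ℚ), Rat.mul_den_eq_num, mul_comm]
    rw [TensorProduct.smul_tmul', smul_eq_mul, this, TensorProduct.smul_tmul, mul_smul]
  | add x y hx hy =>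
    obtain ⟨n, hn, r, hr, hnr⟩ := hx
    obtain ⟨k, hk, s, hs, hks⟩ := hy
    refine ⟨n * k, mul_ne_zero hn hk, k • r + n • s,
      add_mem (E.root.smul_mem _ hr) (E.root.smul_mem _ hs), ?_⟩
    rw [TensorProduct.tmul_add, TensorProduct.tmul_smul, TensorProduct.tmul_smul, ← hnr, ← hks,
      ← Int.cast_smul_eq_zsmul ℚ, ← Int.cast_smul_eq_zsmul ℚ, smul_add, smul_smul, smul_smul,
      Int.cast_mul, mul_comm (n : ℚ)]

lemma eq_zero_of_forall_root (h : E.HasIndexTwoRoot d N rep) {z : ℚ ⊗[ℤ] M}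
    (hz : ∀ r ∈ E.root, E.ratForm z ((1 : ℚ) ⊗ₜ[ℤ] r) = 0) : z = 0 := by
  obtain ⟨n, hn, s, hs, hns⟩ := h.exists_smul_eq z
  have hs0 : (⟨s, hs⟩ : E.root) = 0 := by
    refine h.model.nondeg _ fun r => ?_
    have := hz r r.2
    have h1 : E.ratForm ((1 : ℚ) ⊗ₜ[ℤ] s) ((1 : ℚ) ⊗ₜ[ℤ] (r : M)) = 0 := by
      rw [← hns, map_smul, LinearMap.smul_apply, this, smul_zero]
    rw [ratForm_tmul, one_mul, mul_one] at h1
    exact_mod_cast h1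
  rw [show s = 0 from Subtype.ext_iff.1 hs0, TensorProduct.tmul_zero] at hns
  exact (smul_eq_zero.1 hns).resolve_left (by exact_mod_cast hn)

lemma eq_zero_of_tmul_eq_zero (h : E.HasIndexTwoRoot d N rep) {m : M}
    (hm : (1 : ℚ) ⊗ₜ[ℤ] m = 0) : m = 0 := by
  refine h.torsion m ?_
  have : (⟨(2 : ℤ) • m, h.two_smul_mem m⟩ : E.root) = 0 := by
    refine h.model.nondeg _ fun r => ?_
    have h1 := E.ratForm_tmul 1 1 m r
    rw [hm, map_zero, LinearMap.zero_apply, one_mul, mul_one, eq_comm] at h1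
    have h2 : E.form m r = 0 := by exact_mod_cast h1
    change E.form ((2 : ℤ) • m) r = 0
    rw [map_smul, LinearMap.smul_apply, h2, smul_zero]
  exact Subtype.ext_iff.1 this

/-- The representative in `ℚ ⊗ M` of the class `v` in the discriminant group of the root
sublattice. -/
noncomputable def cls (rep : ℕ → E.root) (v : ℕ) : ℚ ⊗[ℤ] M :=
  (1 / 2 : ℚ) ⊗ₜ[ℤ] (rep v : M)

lemma two_smul_cls (v : ℕ) : (2 : ℚ) • cls rep v = 1 ⊗ₜ[ℤ] (rep v : M) := by
  rw [cls, TensorProduct.smul_tmul']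
  norm_num

lemma ratForm_cls_left (v : ℕ) (m : M) :
    E.ratForm (cls rep v) (1 ⊗ₜ[ℤ] m) = E.form (rep v) m / 2 := by
  rw [cls, ratForm_tmul]
  ring

lemma ratForm_cls (u v : ℕ) :
    E.ratForm (cls rep u) (cls rep v) = E.form (rep u) (rep v) / 4 := by
  rw [cls, cls, ratForm_tmul]
  ring

lemma ratForm_cls_self (h : E.HasIndexTwoRoot d N rep) {v : ℕ} (hv : v < 2 ^ d) :
    E.ratForm (cls rep v) (cls rep v) = -(N v : ℚ) / 2 := by
  have : E.form (rep v) (rep v) = -2 * N v := h.model.norm v hv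
  rw [ratForm_cls, this]
  push_cast
  ring

lemma exists_cls_add (h : E.HasIndexTwoRoot d N rep) {u v : ℕ} (hu : u < 2 ^ d) (hv : v < 2 ^ d) :
    ∃ y ∈ E.root, cls rep u + cls rep v = cls rep (u ^^^ v) + 1 ⊗ₜ[ℤ] y := by
  obtain ⟨y, hy⟩ := h.model.add u hu v hv
  refine ⟨y, y.2, ?_⟩
  have := congrArg (fun z : E.root => (1 / 2 : ℚ) ⊗ₜ[ℤ] (z : M)) hy
  simp only [Submodule.coe_add, Submodule.coe_smul, TensorProduct.tmul_add,
    TensorProduct.tmul_smul, TensorProduct.smul_tmul'] at this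
  rw [cls, cls, cls, this]
  norm_num

/-- Each vector of the dual lattice represents one of the classes. -/
lemma exists_eq_cls_add (h : E.HasIndexTwoRoot d N rep) {x : ℚ ⊗[ℤ] M} (hx : x ∈ E.dual) :
    ∃ v < 2 ^ d, ∃ y ∈ E.root, x = cls rep v + 1 ⊗ₜ[ℤ] y := by
  have hx := E.mem_dual_iff.1 hx
  choose t ht using hx
  let t' : E.root →ₗ[ℤ] ℤ :=
    { toFun := fun r => t r
      map_add' := fun r s => by
        have := ht (r + s)
        rw [TensorProduct.tmul_add, map_add, ht, ht] at this
        exact_mod_cast this.symm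
      map_smul' := fun c r => by
        have := ht (c • (r : M))
        rw [TensorProduct.tmul_smul, map_zsmul, ht, zsmul_eq_mul] at this
        exact_mod_cast this.symm }
  obtain ⟨v, hv, y, hy⟩ := h.model.surj t'
  refine ⟨v, hv, y, y.2, ?_⟩
  rw [← sub_eq_zero]
  refine h.eq_zero_of_forall_root fun r hr => ?_
  have h1 : E.form ((rep v : M) + (2 : ℤ) • (y : M)) r = 2 * t r := hy ⟨r, hr⟩
  rw [map_add, map_smul, LinearMap.add_apply, LinearMap.smul_apply, smul_eq_mul] at h1
  have h2 : (E.form (rep v) r : ℚ) + 2 * E.form y r = 2 * t r := by exact_mod_cast h1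
  rw [map_sub, map_add, LinearMap.sub_apply, LinearMap.add_apply, ht, ratForm_cls_left,
    ratForm_tmul]
  linarith

lemma norm_zero (h : E.HasIndexTwoRoot d N rep) : N 0 = 0 := by
  have := h.model.norm 0 (by positivity)
  rw [h.model.zero, map_zero] at this
  omega

/-- The criterion for orthogonality modulo `1`. -/
lemma orth_iff (h : E.HasIndexTwoRoot d N rep) {u v : ℕ} (hu : u < 2 ^ d) (hv : v < 2 ^ d) :
    FrameCode.orth N u v = true ↔ ∃ k : ℤ, E.ratForm (cls rep u) (cls rep v) = k := by
  obtain ⟨y, hy⟩ := h.model.add u hu v hv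
  have huv := h.model.norm _ (Nat.xor_lt_two_pow hu hv)
  have hu' := h.model.norm u hu
  have hv' := h.model.norm v hv
  obtain ⟨a, ha⟩ := h.model.two_dvd u hu y
  obtain ⟨b, hb⟩ := h.model.two_dvd v hv y
  obtain ⟨c, hc⟩ := (E.restrict E.root).even y
  have hsymm := (E.restrict E.root).symm
  rw [← sub_eq_iff_eq_add] at hy
  rw [← hy] at huv
  simp only [map_sub, map_add, map_smul, LinearMap.sub_apply, LinearMap.add_apply,
    LinearMap.smul_apply, smul_eq_mul, hu', hv', hsymm y, ha, hb, hc, hsymm (rep v) (rep u)] at huv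
  rw [ratForm_cls, FrameCode.orth_iff]
  change _ ↔ ∃ k : ℤ, ((E.restrict E.root).form (rep u) (rep v) : ℚ) / 4 = k
  set z := (E.restrict E.root).form (rep u) (rep v)
  constructor
  · intro ho
    obtain ⟨k, hk⟩ : (4 : ℤ) ∣ z := by omega
    exact ⟨k, by rw [hk]; push_cast; ring⟩
  · rintro ⟨k, hk⟩
    have : z = 4 * k := by
      rw [div_eq_iff (by norm_num), mul_comm] at hk
      exact_mod_cast hk
    omega

/-- The class `γ` of the vectors of `M` outside the root sublattice, and such a vector `g`. Here
`N γ ≠ 4` since `g` is not a root. -/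
lemma exists_glue (h : E.HasIndexTwoRoot d N rep) :
    ∃ γ < 2 ^ d, ∃ g ∉ E.root, 1 ⊗ₜ[ℤ] g = cls rep γ ∧ γ ≠ 0 ∧ N γ % 4 = 0 ∧ N γ ≠ 4 := by
  obtain ⟨g', hg'⟩ := h.exists_notMem
  obtain ⟨γ, hγ, y, hy, hgy⟩ := h.exists_eq_cls_add (E.latticeIn_le_dual ⟨g', rfl⟩)
  have hg : (1 : ℚ) ⊗ₜ[ℤ] (g' - y) = cls rep γ := by
    rw [TensorProduct.tmul_sub, sub_eq_iff_eq_add]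
    exact hgy
  have hgr : g' - y ∉ E.root := fun hr => hg' (by simpa using add_mem hr hy)
  have hN : E.form (g' - y) (g' - y) * 2 = -(N γ : ℤ) := by
    have h1 := h.ratForm_cls_self hγ
    rw [← hg, ratForm_tmul, one_mul, mul_one, eq_div_iff two_ne_zero] at h1
    exact_mod_cast h1
  refine ⟨γ, hγ, g' - y, hgr, hg, ?_, ?_, ?_⟩
  · rintro rfl
    refine hgr ?_
    rw [cls, h.model.zero, ZeroMemClass.coe_zero, TensorProduct.tmul_zero] at hg
    rw [h.eq_zero_of_tmul_eq_zero hg]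
    exact zero_mem _
  · obtain ⟨c, hc⟩ := E.even (g' - y)
    omega
  · intro h4
    -- A vector of norm `-2` belongs to the root sublattice.
    exact hgr (Submodule.subset_span (by change E.form (g' - y) (g' - y) = -2; omega))

lemma cls_mem_dual_iff (h : E.HasIndexTwoRoot d N rep) {γ : ℕ} (hγ : γ < 2 ^ d) {g : M}
    (hgr : g ∉ E.root) (hg : 1 ⊗ₜ[ℤ] g = cls rep γ) {v : ℕ} (hv : v < 2 ^ d) :
    cls rep v ∈ E.dual ↔ FrameCode.orth N v γ = true := by
  rw [mem_dual_iff, h.orth_iff hv hγ]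
  constructor
  · intro hd
    rw [← hg]
    exact hd g
  · rintro ⟨k, hk⟩ m
    have hroot : ∀ r ∈ E.root, ∃ k : ℤ, E.ratForm (cls rep v) (1 ⊗ₜ[ℤ] r) = k := fun r hr => by
      obtain ⟨a, ha⟩ := h.model.two_dvd v hv ⟨r, hr⟩
      have ha : E.form (rep v) r = 2 * a := ha
      refine ⟨a, ?_⟩
      rw [ratForm_cls_left, ha]
      push_cast
      ring
    by_cases hm : m ∈ E.root
    · exact hroot m hm
    · obtain ⟨a, ha⟩ := hroot _ (h.sub_mem_root hm hgr)
      refine ⟨a + k, ?_⟩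
      rw [TensorProduct.tmul_sub, map_sub, hg, hk] at ha
      push_cast
      linarith

open Classical in
/-- The element of the discriminant group `D(M)` that belongs to the class `v`, provided that `v`
is orthogonal to the class of `M`. -/
noncomputable def proj (rep : ℕ → E.root) (v : ℕ) : E.Disc :=
  if h : cls rep v ∈ E.dual then Submodule.Quotient.mk ⟨cls rep v, h⟩ else 0

lemma proj_eq {v : ℕ} (h : cls rep v ∈ E.dual) :
    proj rep v = Submodule.Quotient.mk ⟨cls rep v, h⟩ := dif_pos h

lemma _root_.EvenForm.mk_eq_mk_iff {x y : E.dual} :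
    (Submodule.Quotient.mk x : E.Disc) = Submodule.Quotient.mk y ↔
      ∃ m : M, (1 : ℚ) ⊗ₜ[ℤ] m = (x : ℚ ⊗[ℤ] M) - (y : ℚ ⊗[ℤ] M) :=
  Submodule.Quotient.eq _

lemma discForm_proj (h : E.HasIndexTwoRoot d N rep) {v : ℕ} (hv : v < 2 ^ d)
    (hd : cls rep v ∈ E.dual) :
    E.discForm (proj rep v) = ((-(N v : ℚ) / 2 : ℚ) : AddCircle (2 : ℚ)) := by
  rw [proj_eq hd, ← h.ratForm_cls_self hv]
  rfl

theorem presents (h : E.HasIndexTwoRoot d N rep) {γ : ℕ} (hγ : γ < 2 ^ d) {g : M}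
    (hgr : g ∉ E.root) (hg : 1 ⊗ₜ[ℤ] g = cls rep γ) (hN : N γ % 4 = 0) :
    FrameCode.Presents E.discForm N d γ (proj rep) := by
  have hd : ∀ v < 2 ^ d, FrameCode.orth N v γ = true → cls rep v ∈ E.dual := fun v hv =>
    (h.cls_mem_dual_iff hγ hgr hg hv).2
  have hadd : ∀ u v, u < 2 ^ d → v < 2 ^ d → FrameCode.orth N u γ = true →
      FrameCode.orth N v γ = true → cls rep (u ^^^ v) ∈ E.dual := by
    intro u v hu hv hou hov
    obtain ⟨y, -, hy⟩ := h.exists_cls_add hu hv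
    rw [← sub_eq_iff_eq_add] at hy
    rw [← hy]
    exact sub_mem (add_mem (hd u hu hou) (hd v hv hov)) (E.latticeIn_le_dual ⟨y, rfl⟩)
  have hγγ : FrameCode.orth N γ γ = true := by
    rw [FrameCode.orth_iff, Nat.xor_self, h.norm_zero]
    omega
  refine ⟨hγ, hγγ, ?_, fun u v hu hv hou hov => ?_, fun u v hu hv hou hov => ?_, fun x => ?_,
    fun u v hu hv hou hov => ?_⟩
  · rw [proj_eq (hd γ hγ hγγ), Submodule.Quotient.mk_eq_zero]
    exact ⟨g, hg⟩
  · exact (h.cls_mem_dual_iff hγ hgr hg (Nat.xor_lt_two_pow hu hv)).1 (hadd u v hu hv hou hov)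
  · rw [proj_eq (hadd u v hu hv hou hov), proj_eq (hd u hu hou), proj_eq (hd v hv hov),
      ← Submodule.Quotient.mk_add, eq_comm, mk_eq_mk_iff]
    obtain ⟨y, -, hy⟩ := h.exists_cls_add hu hv
    exact ⟨y, eq_sub_of_add_eq' hy.symm⟩
  · obtain ⟨⟨x, hx⟩, rfl⟩ := Submodule.Quotient.mk_surjective _ x
    obtain ⟨v, hv, y, -, hy⟩ := h.exists_eq_cls_add hx
    have hvd : cls rep v ∈ E.dual := by
      rw [← sub_eq_iff_eq_add] at hy
      rw [← hy]
      exact sub_mem hx (E.latticeIn_le_dual ⟨y, rfl⟩)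
    refine ⟨v, hv, (h.cls_mem_dual_iff hγ hgr hg hv).1 hvd, ?_⟩
    rw [proj_eq hvd, eq_comm, mk_eq_mk_iff]
    exact ⟨y, eq_sub_of_add_eq' hy.symm⟩
  · rw [h.discForm_proj hu (hd u hu hou), h.discForm_proj hv (hd v hv hov)]
    rw [QuotientAddGroup.eq_iff_sub_mem, AddSubgroup.mem_zmultiples_iff]
    constructor
    · rintro ⟨k, hk⟩
      rw [zsmul_eq_mul] at hk
      have : (k * 4 : ℤ) = N v - N u := by
        have : (k * 4 : ℚ) = N v - N u := by linarith
        exact_mod_cast this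
      omega
    · intro hmod
      obtain ⟨k, hk⟩ : (4 : ℤ) ∣ N v - N u := by omega
      refine ⟨k, ?_⟩
      have : (N v - N u : ℚ) = 4 * k := by exact_mod_cast hk
      rw [zsmul_eq_mul]
      linarith

/-- The reflection in twice the minimal representative of a class of norm `-1` induces the
transvection in this class. -/
theorem exists_transvection (h : E.HasIndexTwoRoot d N rep) {γ : ℕ} (hγ : γ < 2 ^ d) {g : M}
    (hgr : g ∉ E.root) (hg : 1 ⊗ₜ[ℤ] g = cls rep γ) (hN : N γ % 4 = 0) {x : ℕ} (hx : x < 2 ^ d)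
    (hxo : FrameCode.orth N x γ = true) (hx2 : N x = 2) :
    ∃ s : E.isometryGroup, ∀ u, u < 2 ^ d → FrameCode.orth N u γ = true →
      E.discEquiv s (proj rep u) =
        if FrameCode.orth N u x = true then proj rep u else proj rep (u ^^^ x) := by
  have hd : ∀ v < 2 ^ d, FrameCode.orth N v γ = true → cls rep v ∈ E.dual := fun v hv =>
    (h.cls_mem_dual_iff hγ hgr hg hv).2
  have hr : E.form (rep x) (rep x) = -4 := by
    have := h.model.norm x hx
    rw [hx2] at this
    exact this
  obtain ⟨f, hf⟩ := E.exists_half (r := (rep x : M)) fun y => by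
    obtain ⟨k, hk⟩ := E.mem_dual_iff.1 (hd x hx hxo) y
    rw [ratForm_cls_left, div_eq_iff two_ne_zero] at hk
    exact ⟨k, by rw [mul_comm]; exact_mod_cast hk⟩
  refine ⟨E.reflection (rep x) f hr hf, fun u hu huo => ?_⟩
  have hsu : ratEquiv (E.reflection (rep x) f hr hf : M ≃ₗ[ℤ] M) (cls rep u) =
      cls rep u + (f (rep u) : ℚ) • cls rep x := by
    rw [cls, ratEquiv_tmul, reflection_apply, TensorProduct.tmul_add, TensorProduct.tmul_smul,
      Int.cast_smul_eq_zsmul]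
    rfl
  have hux : E.ratForm (cls rep u) (cls rep x) = (f (rep u) : ℚ) / 2 := by
    rw [ratForm_cls, E.symm, hf]
    push_cast
    ring
  have ho : FrameCode.orth N u x = true ↔ Even (f (rep u)) := by
    rw [h.orth_iff hu hx, hux]
    constructor
    · rintro ⟨k, hk⟩
      rw [div_eq_iff two_ne_zero] at hk
      exact ⟨k, by rw [← mul_two]; exact_mod_cast hk⟩
    · rintro ⟨k, hk⟩
      exact ⟨k, by rw [hk]; push_cast; ring⟩
  rw [proj_eq (hd u hu huo), discEquiv_mk]
  split_ifs with hou
  · obtain ⟨k, hk⟩ := ho.1 hou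
    rw [mk_eq_mk_iff]
    refine ⟨k • (rep x : M), ?_⟩
    rw [coe_dualEquiv, hsu, add_sub_cancel_left, hk, TensorProduct.tmul_smul, ← two_smul_cls,
      ← Int.cast_smul_eq_zsmul ℚ, smul_smul, ← mul_two, Int.cast_mul, Int.cast_two]
  · obtain ⟨k, hk⟩ := Int.not_even_iff_odd.1 (mt ho.2 hou)
    have hP := h.presents hγ hgr hg hN
    rw [proj_eq (hd _ (Nat.xor_lt_two_pow hu hx) (hP.orth_xor _ _ hu hx huo hxo)), mk_eq_mk_iff]
    obtain ⟨y, -, hy⟩ := h.exists_cls_add hu hx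
    refine ⟨y + k • (rep x : M), ?_⟩
    rw [coe_dualEquiv, hsu, TensorProduct.tmul_add, TensorProduct.tmul_smul, ← two_smul_cls,
      ← Int.cast_smul_eq_zsmul ℚ, hk, Int.cast_add, Int.cast_mul, Int.cast_one, Int.cast_ofNat,
      ← sub_eq_of_eq_add' hy]
    module

theorem discHom_surjective (h : E.HasIndexTwoRoot d N rep)
    (hc : FrameCode.check N d = true) : Function.Surjective E.discHom := by
  obtain ⟨γ, hγ, g, hgr, hg, hγ0, hN, hN4⟩ := h.exists_glue
  have hcheck : FrameCode.checkGlue N d γ = true := by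
    have := FrameCode.allBelow_iff.1 hc γ hγ
    simp only [Bool.or_eq_true, Bool.not_eq_true', ← Bool.not_eq_true, Nat.beq_eq] at this
    tauto
  intro α
  have hα := (h.presents hγ hgr hg hN).mem_of_checkGlue
    (H := E.discHom.range.map E.discIsometryGroup.subtype) hcheck
    (by
      rintro _ ⟨a, -, rfl⟩ x
      exact a.2 x)
    (by
      intro x hx hxo hx2
      obtain ⟨s, hs⟩ := h.exists_transvection hγ hgr hg hN hx hxo hx2
      exact ⟨_, ⟨E.discHom s, ⟨s, rfl⟩, rfl⟩, hs⟩)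
    α.2
  obtain ⟨_, ⟨s, rfl⟩, hs⟩ := hα
  exact ⟨s, Subtype.ext hs⟩

end HasIndexTwoRoot

end EvenForm

/-! ### Frames of K3 surfaces -/

namespace K3HodgeStructure

lemma smul_eq_zero_of_marking {Λ : Type*} [AddCommGroup Λ] (X : K3HodgeStructure Λ) {m : Λ}
    (hm : (2 : ℤ) • m = 0) : m = 0 := by
  obtain ⟨e⟩ := X.marking
  apply e.toLinearEquiv.injective
  have h := congrArg e.toLinearEquiv hm
  rw [map_smul, map_zero] at h
  rw [map_zero]
  exact (smul_eq_zero.1 h).resolve_left two_ne_zero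

namespace HypEmbedding

variable {Λ : Type*} [AddCommGroup Λ] {X : K3HodgeStructure Λ}

lemma B_eq_top (f : X.HypEmbedding) {L R : List LatticeBlock}
    (hLR : (L, R) ∈ LatticeBlock.alternateFrames) (hf : f.HasFrame R) : f.B = ⊤ := by
  obtain ⟨⟨e⟩, hindex⟩ := hf
  obtain ⟨rep, hrep⟩ := LatticeBlock.exists_dualModel R
    (LatticeBlock.isModeled_of_mem_alternateFrames hLR)
  have h : f.formK.HasIndexTwoRoot _ _ _ :=
    { torsion := fun m hm => Subtype.ext
        (X.smul_eq_zero_of_marking (by simpa using congrArg Subtype.val hm))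
      index := hindex
      model := hrep.congr e.toLinearEquiv.symm fun x y => by
        rw [← e.map_app' (e.toLinearEquiv.symm x) (e.toLinearEquiv.symm y)]
        change LatticeBlock.sumForm R (e.toLinearEquiv (e.toLinearEquiv.symm x))
          (e.toLinearEquiv (e.toLinearEquiv.symm y)) = _
        rw [LinearEquiv.apply_symm_apply, LinearEquiv.apply_symm_apply] }
  exact MonoidHom.range_eq_top.2
    (h.discHom_surjective (LatticeBlock.check_of_mem_alternateFrames hLR))

lemma multiplicity_eq_one_of_B_eq_top (f : X.HypEmbedding) (h : f.B = ⊤) :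
    f.multiplicity = 1 := by
  rw [multiplicity, Nat.card_eq_one_iff_unique]
  refine ⟨⟨fun a b => ?_⟩, ⟨DoubleCoset.mk f.C f.B 1⟩⟩
  induction a using Quotient.inductionOn' with | _ a
  induction b using Quotient.inductionOn' with | _ b
  refine (DoubleCoset.eq f.C f.B a b).2 ⟨1, one_mem _, a⁻¹ * b, ?_, by group⟩
  rw [h]
  exact Subgroup.mem_top _

end HypEmbedding

end K3HodgeStructure

theorem mainTheorem4 {Λ : Type*} [AddCommGroup Λ] (X : K3HodgeStructure Λ)
    (L R : List LatticeBlock) (hLR : (L, R) ∈ LatticeBlock.alternateFrames)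
    (hNS : (X.form.restrict X.NS).Equivalent (LatticeBlock.sumForm L))
    (f : X.HypEmbedding) (hf : f.HasFrame R) :
    f.multiplicity = 1 :=
  f.multiplicity_eq_one_of_B_eq_top (f.B_eq_top hLR hf)
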